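/- Let $k$ be a separably closed field and let $U$ be an affine $k$-group scheme on which a finite group $\Gamma$ acts by automorphisms of the $k$-group $U$. Let $$U=U_0\supseteq U_1\supseteq U_2\supseteq\cdots$$ be a decreasing sequence of closed subgroup schemes of $U$, each normal in $U$ and stable under $\Gamma$, such that $U=\varprojlim_i U/U_i$ and such that for every $i\ge 0$ the quotient $U_i/U_{i+1}$ is a unipotent algebraic $k$-group (so that $U$ is pro-unipotent). Assume that the order of $\Gamma$ is invertible in $k$ and that every $U_i/U_{i+1}$ is smooth and connected. Then the non-abelian cohomology set $H^1(\Gamma,U(k))$ is trivial: $H^1(\Gamma,U(k))=1$. -/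

import Mathlib

/-!
Affine group schemes over a field `k` are represented by their coordinate rings, i.e. by
commutative Hopf algebras over `k` (`U = Spec A`). Closed subgroup schemes of `U` are the
subschemes cut out by Hopf ideals of `A` (`Ideal.IsHopfIdeal`), and a morphism `G ⟶ H` of affine
group schemes is a bialgebra homomorphism `k[H] →ₐc[k] k[G]`.
-/

open scoped TensorProduct

/-! ### Non-abelian first cohomology -/

/-- The `1`-cocycles of a group `Γ` acting through `φ` by automorphisms on a (not necessarily
commutative) group `G`: maps `c : Γ → G` with `c (s t) = c s · ˢ(c t)`. -/
structure OneCocycle {Γ G : Type*} [Group Γ] [Group G] (φ : Γ →* MulAut G) where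
  toFun : Γ → G
  map_mul' : ∀ s t : Γ, toFun (s * t) = toFun s * φ s (toFun t)

/-- Two cocycles `c, c'` are cohomologous if `c' s = g⁻¹ · c s · ˢg` for some `g`. -/
def OneCocycle.setoid {Γ G : Type*} [Group Γ] [Group G] (φ : Γ →* MulAut G) :
    Setoid (OneCocycle φ) where
  r c c' := ∃ g : G, ∀ s : Γ, c'.toFun s = g⁻¹ * c.toFun s * φ s g
  iseqv :=
    { refl := fun c => ⟨1, fun s => by simp⟩
      symm := by
        rintro c c' ⟨g, hg⟩
        exact ⟨g⁻¹, fun s => by rw [hg s]; simp [mul_assoc]⟩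
      trans := by
        rintro c c' c'' ⟨g, hg⟩ ⟨h, hh⟩
        exact ⟨g * h, fun s => by rw [hh s, hg s]; simp [mul_assoc]⟩ }

/-- The pointed set `H¹(Γ, G)`. -/
def NonabelianH1 {Γ G : Type*} [Group Γ] [Group G] (φ : Γ →* MulAut G) : Type _ :=
  Quotient (OneCocycle.setoid φ)

/-- The base point of `H¹(Γ, G)`: the class of the constant cocycle `1`. -/
instance {Γ G : Type*} [Group Γ] [Group G] (φ : Γ →* MulAut G) : One (NonabelianH1 φ) :=
  ⟨Quotient.mk (OneCocycle.setoid φ) ⟨fun _ => 1, fun s t => by simp⟩⟩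

universe u

namespace AffineGroup

/-- The group `U(R)` of `R`-points of `U = Spec A`, with its convolution group structure
(the product of `g` and `h` is `A ⟶ A ⊗ A ⟶ R`, comultiplication followed by `g ⊗ h`). -/
abbrev Points (k A R : Type u) [Field k] [CommRing A] [HopfAlgebra k A] [CommRing R]
    [Algebra k R] : Type u :=
  WithConv (A →ₐ[k] R)

/-- A left action of an abstract group `Γ` on `U = Spec A` by automorphisms of the `k`-group `U`.
It is given by the comorphisms `comap s : A → A` of the automorphisms `s : U → U`; passing to
comorphisms reverses composition. -/
structure Action (k A Γ : Type*) [Field k] [CommRing A] [HopfAlgebra k A] [Group Γ] where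
  comap : Γ → (A →ₐc[k] A)
  comap_one : comap 1 = BialgHom.id k A
  comap_mul : ∀ s t : Γ, comap (s * t) = (comap t).comp (comap s)

/-- The action of `Γ` on `U(R)` induced by an action on the `k`-group `U`: `s` sends the point
`x : A → R` to `x ∘ comap s`. -/
def Action.onPoints {k A : Type u} {Γ : Type*} [Field k] [CommRing A] [HopfAlgebra k A] [Group Γ]
    (ρ : Action k A Γ) (R : Type u) [CommRing R] [Algebra k R] :
    Γ →* MulAut (Points k A R) where
  toFun s :=
    { toFun := fun x => WithConv.toConv (x.ofConv.comp (ρ.comap s : A →ₐ[k] A))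
      invFun := fun x => WithConv.toConv (x.ofConv.comp (ρ.comap s⁻¹ : A →ₐ[k] A))
      left_inv := fun x => by
        have h := ρ.comap_mul s⁻¹ s
        rw [inv_mul_cancel, ρ.comap_one] at h
        ext a
        exact congrArg x.ofConv (DFunLike.congr_fun h a).symm
      right_inv := fun x => by
        have h := ρ.comap_mul s s⁻¹
        rw [mul_inv_cancel, ρ.comap_one] at h
        ext a
        exact congrArg x.ofConv (DFunLike.congr_fun h a).symm
      map_mul' := fun x y => by
        apply WithConv.ofConv_injective
        exact AlgHom.convMul_comp_bialgHom_distrib x y (ρ.comap s) }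
  map_one' := by
    ext x a
    exact congrArg x.ofConv (DFunLike.congr_fun ρ.comap_one a)
  map_mul' s t := by
    ext x a
    exact congrArg x.ofConv (DFunLike.congr_fun (ρ.comap_mul s t) a)

/-- The closed subgroup `N = V(I)` of `U = Spec A` is normal: for every commutative `k`-algebra
`R`, the subset `N(R)` of `U(R)` is stable under conjugation by `U(R)`. (All elements of `U(R)` are
units of the monoid `Points k A R`, with inverse given by the antipode.) -/
def IsNormal (k : Type u) {A : Type u} [Field k] [CommRing A] [HopfAlgebra k A]
    (I : Ideal A) : Prop :=
  ∀ (R : Type u) [CommRing R] [Algebra k R] (g : (Points k A R)ˣ) (n : Points k A R),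
    (∀ a ∈ I, n.ofConv a = 0) → ∀ a ∈ I, (g * n * (g⁻¹ : (Points k A R)ˣ)).ofConv a = 0

/-- The closed subgroup `V(I)` of `U = Spec A` is stable under the action of `Γ`. -/
def Action.Stabilizes {k A Γ : Type*} [Field k] [CommRing A] [HopfAlgebra k A] [Group Γ]
    (ρ : Action k A Γ) (I : Ideal A) : Prop :=
  ∀ (s : Γ), ∀ a ∈ I, ρ.comap s a ∈ I

/-- The homomorphism `G = Spec B ⟶ Spec Q` given by `π` presents `Spec Q` as the quotient of `G`
by its closed subgroup `N = V(J)`, i.e. `1 ⟶ N ⟶ G ⟶ Spec Q ⟶ 1` is an exact sequence of affine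
group schemes: `π` is faithfully flat, and its scheme-theoretic kernel, which is defined by the
ideal of `B` generated by the image of the augmentation ideal of `Q`, is `N`. -/
structure IsQuotient {k B Q : Type*} [Field k] [CommRing B] [HopfAlgebra k B]
    [CommRing Q] [HopfAlgebra k Q] (J : Ideal B) (π : Q →ₐc[k] B) : Prop where
  faithfullyFlat : ((π : Q →ₐ[k] B) : Q →+* B).FaithfullyFlat
  kernel_eq : (RingHom.ker (Bialgebra.counitAlgHom k Q)).map (π : Q →ₐ[k] B) = J

/-- The affine `k`-group `Spec Q` is a unipotent algebraic group: it is isomorphic to a closed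
subgroup of the group of upper triangular unipotent matrices of some size `n`.
A homomorphism from `Spec Q` to that group is an upper unitriangular matrix `m` over `Q` with
`Δ(m i j) = ∑ l, m i l ⊗ m l j` and `ε(m i j) = δ i j` (on points, `g ↦ (g (m i j))`),
and it is a closed immersion iff the entries of `m` generate the algebra `Q`. -/
def IsUnipotent (k Q : Type*) [Field k] [CommRing Q] [HopfAlgebra k Q] : Prop :=
  ∃ (n : ℕ) (m : Matrix (Fin n) (Fin n) Q),
    (∀ i, m i i = 1) ∧ (∀ i j, j < i → m i j = 0) ∧
    (∀ i j, Coalgebra.comul (R := k) (m i j) = ∑ l, m i l ⊗ₜ[k] m l j) ∧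
    (∀ i j, Coalgebra.counit (R := k) (m i j) = if i = j then 1 else 0) ∧
    Algebra.adjoin k {a : Q | ∃ i j, a = m i j} = ⊤

/-- The coordinate ring of `U/N`, for `U = Spec A` and a closed subgroup `N = V(I)`: the algebra
of functions `f` on `U` with `f (u n) = f u` for all points `u` of `U` and `n` of `N`, that is of
all `a` whose image under `A ⟶ A ⊗ A ⟶ A ⊗ A/I` is `a ⊗ 1`. -/
noncomputable def invariants (k : Type*) {A : Type*} [Field k] [CommRing A] [HopfAlgebra k A]
    (I : Ideal A) : Subalgebra k A :=
  AlgHom.equalizer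
    ((Algebra.TensorProduct.map (AlgHom.id k A) (Ideal.Quotient.mkₐ k I)).comp
      (Bialgebra.comulAlgHom k A))
    (Algebra.TensorProduct.includeLeft : A →ₐ[k] A ⊗[k] (A ⧸ I))

/-- `U = lim U/U i` for a decreasing sequence of closed subgroups `U i = V(I i)` of `U = Spec A`:
on coordinate rings this says that `A` is the union of the increasing sequence of coordinate
rings of the `U/U i`. -/
def IsLimitOfQuotients (k : Type*) {A : Type*} [Field k] [CommRing A] [HopfAlgebra k A]
    (I : ℕ → Ideal A) : Prop :=
  ∀ a : A, ∃ i, a ∈ invariants k (I i)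

end AffineGroup

/-!
Write `m = |Γ|`. The group `U(k)` is filtered by the subgroups `U i (k)`, and the argument climbs
this filtration.

*Completeness.* A function on `U / U i` takes the same values at points of `U(k)` which agree
modulo `U i (k)`. As `k[U]` is the union of the rings of functions on the `U / U i`, the group
`U(k)` is separated and complete for the filtration (`exists_limit_of_points`). It is therefore
enough to move a cocycle with values in `U i (k)` into `U (i + 1) (k)`
(`OneCocycle.exists_twist_eq_one_of_filtration`).

*Graded pieces.* The group `U i (k) / U (i + 1) (k)` need not be all of `(U i / U (i + 1))(k)`, but
it embeds in it, hence in a group of unitriangular matrices over `k`. So it is nilpotent, and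
`x ↦ x ^ m` is injective on it. If `x ↦ x ^ m` is also surjective, then every cocycle in it is
trivial: by induction along the upper central series this reduces to cocycles in the centre, which
are killed by averaging (`OneCocycle.exists_twist_eq_one_of_isNilpotent`).

*Roots.* In characteristic `p` unitriangular matrices have order a power of `p`, which is prime
to `m`, so surjectivity is clear. In characteristic zero, `m`-th roots are constructed in `U i (k)`
itself. For a point `x` of `U(k)` and a function `f`, the value `f (x ^ t)` is a polynomial in the
natural number `t`, because `x - 1` acts locally nilpotently on `k[U]`. Putting `t = 1 / m` in these
polynomials gives a point `y` with `y ^ m = x`, and `y` lies in every closed subgroup that contains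
`x` (`exists_pow_eq_of_isConilpotent`).

*Local nilpotency.* This last input, `isConilpotent_of_tower`, says that the successive
extension `U` of unipotent groups is itself (pro-)unipotent. A nonzero representation of `U` with a
nonzero vector fixed by `U (i + 1)` has a nonzero vector fixed by `U i`
(`RightCoaction.exists_fixed_of_isQuotient`): by faithfully flat descent along
`U i → U i / U (i + 1)`, the coefficients of a vector fixed by `U (i + 1)` are functions on the
unipotent group `U i / U (i + 1)`. Apply this, down to `i = 0`, to the quotient of `k[U]` by the
largest subspace on which `U` acts unipotently: it can have no nonzero fixed vector, so it is zero.
-/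

open scoped TensorProduct

/-! ### Slices of tensors -/

section Slice

variable {k M M' N N' : Type*} [Field k] [AddCommGroup M] [Module k M] [AddCommGroup M']
  [Module k M'] [AddCommGroup N] [Module k N] [AddCommGroup N'] [Module k N']

/-- Contraction of the second tensor factor against a linear form. -/
noncomputable def tensorSlice (M : Type*) [AddCommGroup M] [Module k M] (φ : N →ₗ[k] k) :
    M ⊗[k] N →ₗ[k] M :=
  (TensorProduct.rid k M).toLinearMap ∘ₗ φ.lTensor M

@[simp]
lemma tensorSlice_tmul (φ : N →ₗ[k] k) (x : M) (y : N) :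
    tensorSlice M φ (x ⊗ₜ[k] y) = φ y • x := by
  simp [tensorSlice]

lemma eq_zero_of_tensorSlice_eq_zero {z : M ⊗[k] N}
    (h : ∀ φ : N →ₗ[k] k, tensorSlice M φ z = 0) : z = 0 := by
  classical
  let b := Module.Basis.ofVectorSpace k N
  apply (TensorProduct.equivFinsuppOfBasisRight b).injective
  ext i
  rw [TensorProduct.equivFinsuppOfBasisRight_apply, map_zero, Finsupp.zero_apply]
  exact h _

lemma tensorSlice_rTensor (f : M →ₗ[k] M') (φ : N →ₗ[k] k) (z : M ⊗[k] N) :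
    tensorSlice M' φ (f.rTensor N z) = f (tensorSlice M φ z) := by
  induction z with
  | zero => simp
  | add x y hx hy => simp [hx, hy]
  | tmul x y => simp

lemma tensorSlice_lTensor (f : N →ₗ[k] N') (φ : N' →ₗ[k] k) (z : M ⊗[k] N) :
    tensorSlice M φ (f.lTensor M z) = tensorSlice M (φ ∘ₗ f) z := by
  induction z with
  | zero => simp
  | add x y hx hy => simp [hx, hy]
  | tmul x y => simp

lemma tensorSlice_sub (φ ψ : N →ₗ[k] k) (z : M ⊗[k] N) :
    tensorSlice M (φ - ψ) z = tensorSlice M φ z - tensorSlice M ψ z := by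
  simp [tensorSlice, LinearMap.lTensor_sub]

lemma tensorSlice_smul (c : k) (φ : N →ₗ[k] k) (z : M ⊗[k] N) :
    tensorSlice M (c • φ) z = c • tensorSlice M φ z := by
  simp [tensorSlice, LinearMap.lTensor_smul]

/-- A tensor all of whose slices lie in a subspace `F` is a sum of pure tensors with left
factors in `F`. -/
lemma exists_finset_sum_tmul_of_tensorSlice_mem (F : Submodule k M) {z : M ⊗[k] N}
    (h : ∀ φ : N →ₗ[k] k, tensorSlice M φ z ∈ F) :
    ∃ S : Finset (M × N), (∀ p ∈ S, p.1 ∈ F) ∧ z = ∑ p ∈ S, p.1 ⊗ₜ[k] p.2 := by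
  classical
  have h0 : F.mkQ.rTensor N z = 0 := by
    apply eq_zero_of_tensorSlice_eq_zero
    intro φ
    rw [tensorSlice_rTensor, Submodule.mkQ_apply, Submodule.Quotient.mk_eq_zero]
    exact h φ
  have hex := rTensor_exact N (f := F.subtype) (g := F.mkQ)
    (LinearMap.exact_subtype_mkQ F) (Submodule.mkQ_surjective F)
  obtain ⟨w, rfl⟩ := (hex z).1 h0
  obtain ⟨S, rfl⟩ := TensorProduct.exists_finset w
  refine ⟨S.image fun p => ((p.1 : M), p.2), ?_, ?_⟩
  · simp only [Finset.mem_image]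
    rintro _ ⟨p, -, rfl⟩
    exact p.1.2
  · rw [Finset.sum_image, map_sum]
    · exact Finset.sum_congr rfl fun p _ => rfl
    · rintro ⟨a, b⟩ - ⟨c, d⟩ - hpq
      rw [Prod.mk.injEq] at hpq ⊢
      exact ⟨Subtype.ext hpq.1, hpq.2⟩

end Slice

/-! ### Coactions and fixed vectors -/

/-- A right coaction of a coalgebra `B` on a vector space `M`, that is, when `B` is the coordinate
ring of an affine group, a linear representation of this group on `M`. -/
structure RightCoaction (k B M : Type*) [Field k] [AddCommGroup B] [Module k B] [Coalgebra k B]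
    [AddCommGroup M] [Module k M] where
  coact : M →ₗ[k] M ⊗[k] B
  coassoc : ∀ v, TensorProduct.assoc k M B B (coact.rTensor B (coact v)) =
    (Coalgebra.comul (R := k) (A := B)).lTensor M (coact v)
  counit : ∀ v, tensorSlice M (Coalgebra.counit (R := k) (A := B)) (coact v) = v

namespace RightCoaction

section Coalgebra

variable {k B M : Type*} [Field k] [AddCommGroup B] [Module k B] [Coalgebra k B]
  [AddCommGroup M] [Module k M]

/-- The right regular representation, on the functions on the group. -/
def regular (k B : Type*) [Field k] [AddCommGroup B] [Module k B] [Coalgebra k B] :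
    RightCoaction k B B where
  coact := Coalgebra.comul
  coassoc v := Coalgebra.coassoc_apply v
  counit v := by simp [tensorSlice]

/-- The action of a linear form `φ` on `B`, seen as an element of the group algebra, on `M`. -/
noncomputable def act (ρ : RightCoaction k B M) (φ : B →ₗ[k] k) : M →ₗ[k] M :=
  tensorSlice M φ ∘ₗ ρ.coact

lemma act_apply (ρ : RightCoaction k B M) (φ : B →ₗ[k] k) (v : M) :
    ρ.act φ v = tensorSlice M φ (ρ.coact v) := rfl

lemma coact_act (ρ : RightCoaction k B M) (φ : B →ₗ[k] k) (v : M) :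
    ρ.coact (ρ.act φ v) = ((regular k B).act φ).lTensor M (ρ.coact v) := by
  have h1 : ∀ t : M ⊗[k] (B ⊗[k] B),
      tensorSlice (M ⊗[k] B) φ ((TensorProduct.assoc k M B B).symm t) =
        (tensorSlice B φ).lTensor M t := by
    intro t
    induction t with
    | zero => simp
    | add x y hx hy => simp [hx, hy]
    | tmul x y =>
      induction y with
      | zero => simp
      | add y z hy hz => simp [TensorProduct.tmul_add, hy, hz]
      | tmul y z => simp
  rw [act_apply, ← tensorSlice_rTensor]
  have h2 := (TensorProduct.assoc k M B B).symm_apply_apply (ρ.coact.rTensor B (ρ.coact v))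
  rw [← h2, ρ.coassoc, h1, ← LinearMap.comp_apply, ← LinearMap.lTensor_comp]
  rfl

end Coalgebra

section Bialgebra

variable {k B M : Type*} [Field k] [CommRing B] [Bialgebra k B] [AddCommGroup M] [Module k M]

lemma act_eq_sub_add (ρ : RightCoaction k B M) (φ : B →ₗ[k] k) (v : M) :
    ρ.act φ v = ρ.act (φ - φ 1 • Coalgebra.counit) v + φ 1 • v := by
  conv_rhs => rw [act_apply, tensorSlice_sub, tensorSlice_smul, ρ.counit]
  rw [act_apply, sub_add_cancel]

lemma sub_smul_counit_apply_one (φ : B →ₗ[k] k) :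
    (φ - φ 1 • Coalgebra.counit (R := k) (A := B)) 1 = 0 := by
  simp

/-- A vector is fixed by the group as soon as it is killed by every linear form on `B` that
vanishes at `1`; these linear forms are the augmentation ideal of the group algebra. -/
lemma coact_eq_tmul_one (ρ : RightCoaction k B M) {v : M}
    (h : ∀ φ : B →ₗ[k] k, φ 1 = 0 → ρ.act φ v = 0) : ρ.coact v = v ⊗ₜ 1 := by
  rw [← sub_eq_zero]
  apply eq_zero_of_tensorSlice_eq_zero
  intro φ
  rw [map_sub, ← act_apply, act_eq_sub_add, h _ (sub_smul_counit_apply_one φ)]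
  simp

lemma act_eq_zero_of_coact_eq_tmul_one (ρ : RightCoaction k B M) {v : M}
    (h : ρ.coact v = v ⊗ₜ 1) {φ : B →ₗ[k] k} (hφ : φ 1 = 0) : ρ.act φ v = 0 := by
  simp [act_apply, h, hφ]

/-- The `n`-th step of the ascending filtration of a representation by the vectors killed by the
`n`-th power of the augmentation ideal of the group algebra. -/
noncomputable def filt (ρ : RightCoaction k B M) : ℕ → Submodule k M
  | 0 => ⊥
  | n + 1 => ⨅ (φ : B →ₗ[k] k) (_ : φ 1 = 0), (ρ.filt n).comap (ρ.act φ)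

lemma mem_filt_zero (ρ : RightCoaction k B M) {v : M} : v ∈ ρ.filt 0 ↔ v = 0 := by
  simp [filt]

lemma mem_filt_succ (ρ : RightCoaction k B M) {n : ℕ} {v : M} :
    v ∈ ρ.filt (n + 1) ↔ ∀ φ : B →ₗ[k] k, φ 1 = 0 → ρ.act φ v ∈ ρ.filt n := by
  simp [filt, Submodule.mem_iInf]

lemma filt_mono (ρ : RightCoaction k B M) : Monotone ρ.filt := by
  apply monotone_nat_of_le_succ
  intro n
  induction n with
  | zero => intro v hv; rw [mem_filt_zero] at hv; simp [hv]
  | succ n ih =>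
    intro v hv
    rw [mem_filt_succ] at hv ⊢
    exact fun φ hφ => ih (hv φ hφ)

lemma act_mem_filt (ρ : RightCoaction k B M) {n : ℕ} {v : M} (hv : v ∈ ρ.filt n)
    (φ : B →ₗ[k] k) : ρ.act φ v ∈ ρ.filt n := by
  cases n with
  | zero => simp [ρ.mem_filt_zero.1 hv]
  | succ n =>
    rw [act_eq_sub_add]
    exact add_mem (ρ.filt_mono n.le_succ (ρ.mem_filt_succ.1 hv _ (sub_smul_counit_apply_one φ)))
      (Submodule.smul_mem _ _ hv)

/-- A representation on which the group acts unipotently and which is not zero has a nonzero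
fixed vector. -/
lemma exists_fixed_of_mem_filt (ρ : RightCoaction k B M) (n : ℕ) {v : M} (hv : v ∈ ρ.filt n)
    (hv0 : v ≠ 0) : ∃ v', v' ≠ 0 ∧ ρ.coact v' = v' ⊗ₜ 1 := by
  induction n generalizing v with
  | zero => exact absurd (ρ.mem_filt_zero.1 hv) hv0
  | succ n ih =>
    by_cases h : ∀ φ : B →ₗ[k] k, φ 1 = 0 → ρ.act φ v = 0
    · exact ⟨v, hv0, ρ.coact_eq_tmul_one h⟩
    · push Not at h
      obtain ⟨φ, hφ, hne⟩ := h
      exact ih (ρ.mem_filt_succ.1 hv φ hφ) hne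

/-- A bialgebra is conilpotent if every element is killed by some power of the augmentation ideal
of the dual algebra. For the coordinate ring of an affine group, this says that the group is
(pro-)unipotent. -/
def _root_.IsConilpotent (k B : Type*) [Field k] [CommRing B] [Bialgebra k B] : Prop :=
  ∀ b : B, ∃ n, b ∈ (regular k B).filt n

/-- The restriction of a representation along a homomorphism of groups. -/
noncomputable def restrict {C : Type*} [CommRing C] [Bialgebra k C] (ρ : RightCoaction k B M)
    (f : B →ₐc[k] C) : RightCoaction k C M where
  coact := (f : B →ₗ[k] C).lTensor M ∘ₗ ρ.coact
  coassoc v := by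
    have h := congrArg (TensorProduct.map LinearMap.id
      (TensorProduct.map (f : B →ₗ[k] C) (f : B →ₗ[k] C))) (ρ.coassoc v)
    have hf : (Coalgebra.comul (R := k) (A := C)) ∘ₗ (f : B →ₗ[k] C) =
        TensorProduct.map (f : B →ₗ[k] C) (f : B →ₗ[k] C) ∘ₗ Coalgebra.comul := by
      ext b; exact (CoalgHomClass.map_comp_comul_apply f b).symm
    have hr : ∀ t : M ⊗[k] B, TensorProduct.map LinearMap.id
        (TensorProduct.map (f : B →ₗ[k] C) (f : B →ₗ[k] C)) (Coalgebra.comul.lTensor M t) =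
        Coalgebra.comul.lTensor M ((f : B →ₗ[k] C).lTensor M t) := by
      intro t
      rw [← LinearMap.comp_apply (LinearMap.lTensor M Coalgebra.comul), ← LinearMap.lTensor_comp,
        hf, LinearMap.lTensor_comp]
      rfl
    have hl : ∀ t : M ⊗[k] B, TensorProduct.map LinearMap.id
        (TensorProduct.map (f : B →ₗ[k] C) (f : B →ₗ[k] C))
          (TensorProduct.assoc k M B B (ρ.coact.rTensor B t)) =
        TensorProduct.assoc k M C C (((f : B →ₗ[k] C).lTensor M ∘ₗ ρ.coact).rTensor C
          ((f : B →ₗ[k] C).lTensor M t)) := by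
      intro t
      induction t with
      | zero => simp
      | add x y hx hy => simp only [map_add, hx, hy]
      | tmul x y =>
        simp only [LinearMap.rTensor_tmul, LinearMap.lTensor_tmul, LinearMap.comp_apply]
        generalize ρ.coact x = w
        induction w with
        | zero => simp
        | add x y hx hy => simp only [map_add, TensorProduct.add_tmul, hx, hy]
        | tmul x y => simp
    rw [hr, hl] at h
    exact h
  counit v := by
    have hf : Coalgebra.counit ∘ₗ (f : B →ₗ[k] C) = Coalgebra.counit (R := k) (A := B) := by
      ext b; exact CoalgHomClass.counit_comp_apply f b
    rw [LinearMap.comp_apply, tensorSlice_lTensor, hf, ρ.counit]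

/-- The representation on the quotient by a stable subspace. -/
noncomputable def quotient (ρ : RightCoaction k B M) (F : Submodule k M)
    (hF : ∀ v ∈ F, ∀ φ : B →ₗ[k] k, ρ.act φ v ∈ F) : RightCoaction k B (M ⧸ F) where
  coact := F.liftQ (F.mkQ.rTensor B ∘ₗ ρ.coact) (by
    intro v hv
    rw [LinearMap.mem_ker]
    apply eq_zero_of_tensorSlice_eq_zero
    intro φ
    rw [LinearMap.comp_apply, tensorSlice_rTensor, Submodule.mkQ_apply,
      Submodule.Quotient.mk_eq_zero]
    exact hF v hv φ)
  coassoc v := by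
    obtain ⟨v, rfl⟩ := F.mkQ_surjective v
    have h := congrArg (F.mkQ.rTensor (B ⊗[k] B)) (ρ.coassoc v)
    simp only [Submodule.mkQ_apply, Submodule.liftQ_apply, LinearMap.comp_apply]
    have hr : ∀ t : M ⊗[k] B, F.mkQ.rTensor (B ⊗[k] B) (Coalgebra.comul.lTensor M t) =
        Coalgebra.comul.lTensor (M ⧸ F) (F.mkQ.rTensor B t) := by
      intro t
      rw [LinearMap.lTensor, LinearMap.lTensor, LinearMap.rTensor, LinearMap.rTensor,
        ← LinearMap.comp_apply, ← LinearMap.comp_apply, ← TensorProduct.map_comp,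
        ← TensorProduct.map_comp]
      simp
    rw [← hr, ← h]
    generalize ρ.coact v = t
    induction t with
    | zero => simp
    | add x y hx hy => simp only [map_add, hx, hy]
    | tmul x y =>
      simp only [LinearMap.rTensor_tmul, Submodule.mkQ_apply, Submodule.liftQ_apply,
        LinearMap.comp_apply]
      generalize ρ.coact x = w
      induction w with
      | zero => simp
      | add x y hx hy => simp only [map_add, TensorProduct.add_tmul, hx, hy]
      | tmul x y => simp
  counit v := by
    obtain ⟨v, rfl⟩ := F.mkQ_surjective v
    simp only [Submodule.mkQ_apply, Submodule.liftQ_apply, LinearMap.comp_apply]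
    rw [tensorSlice_rTensor, ρ.counit, Submodule.mkQ_apply]

end Bialgebra

end RightCoaction

/-! ### Unipotent groups have conilpotent coordinate rings -/

section Unipotent

open RightCoaction

variable {k Q : Type*} [Field k] [CommRing Q] [Bialgebra k Q]

lemma exists_comul_eq_of_mem_filt_succ {n : ℕ} {q : Q} (hq : q ∈ (regular k Q).filt (n + 1)) :
    ∃ S : Finset (Q × Q), (∀ p ∈ S, p.1 ∈ (regular k Q).filt n) ∧
      Coalgebra.comul (R := k) q = q ⊗ₜ 1 + ∑ p ∈ S, p.1 ⊗ₜ[k] p.2 := by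
  have h : ∀ φ : Q →ₗ[k] k, tensorSlice Q φ (Coalgebra.comul (R := k) q - q ⊗ₜ 1) ∈
      (regular k Q).filt n := by
    intro φ
    have h1 := (regular k Q).act_eq_sub_add φ q
    rw [map_sub, tensorSlice_tmul]
    change (regular k Q).act φ q - φ 1 • q ∈ _
    rw [h1, add_sub_cancel_right]
    exact (mem_filt_succ _).1 hq _ (sub_smul_counit_apply_one φ)
  obtain ⟨S, hS, hz⟩ := exists_finset_sum_tmul_of_tensorSlice_mem _ h
  exact ⟨S, hS, by rw [← hz]; abel⟩

lemma exists_comul_eq_of_mem_filt {n : ℕ} {q : Q} (hq : q ∈ (regular k Q).filt n) :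
    ∃ S : Finset (Q × Q), (∀ p ∈ S, p.1 ∈ (regular k Q).filt n) ∧
      Coalgebra.comul (R := k) q = ∑ p ∈ S, p.1 ⊗ₜ[k] p.2 :=
  exists_finset_sum_tmul_of_tensorSlice_mem _ fun φ => act_mem_filt _ hq φ

lemma mul_mem_filt {a b : ℕ} {q r : Q} (hq : q ∈ (regular k Q).filt a)
    (hr : r ∈ (regular k Q).filt b) : q * r ∈ (regular k Q).filt (a + b) := by
  induction hn : a + b using Nat.strong_induction_on generalizing a b q r with
  | _ n ih =>
  subst hn
  match a, b with
  | 0, _ => simp [(mem_filt_zero _).1 hq]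
  | _, 0 => simp [(mem_filt_zero _).1 hr]
  | a + 1, b + 1 =>
    rw [show a + 1 + (b + 1) = (a + b + 1) + 1 by ring, mem_filt_succ]
    intro φ hφ
    obtain ⟨S, hS, hq'⟩ := exists_comul_eq_of_mem_filt_succ hq
    obtain ⟨T, hT, hr'⟩ := exists_comul_eq_of_mem_filt_succ hr
    obtain ⟨T', hT', hr''⟩ := exists_comul_eq_of_mem_filt hr
    have h : Coalgebra.comul (R := k) (q * r) =
        (q * r) ⊗ₜ 1 + ∑ p ∈ T, (q * p.1) ⊗ₜ[k] p.2 +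
          ∑ s ∈ S, ∑ p ∈ T', (s.1 * p.1) ⊗ₜ[k] (s.2 * p.2) := by
      have : ∑ s ∈ S, ∑ p ∈ T', (s.1 * p.1) ⊗ₜ[k] (s.2 * p.2) =
          (∑ p ∈ S, p.1 ⊗ₜ[k] p.2) * Coalgebra.comul (R := k) r := by
        rw [hr'', Finset.sum_mul_sum]
        simp
      rw [this, Bialgebra.comul_mul, hq', add_mul]
      congr 1
      rw [hr', mul_add, Finset.mul_sum]
      simp
    rw [act_apply]
    change tensorSlice Q φ (Coalgebra.comul (R := k) (q * r)) ∈ _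
    rw [h]
    simp only [map_add, map_sum, tensorSlice_tmul, hφ, zero_smul, zero_add]
    refine add_mem (sum_mem fun p hp => Submodule.smul_mem _ _ ?_)
      (sum_mem fun s hs => sum_mem fun p hp => Submodule.smul_mem _ _ ?_)
    · exact ih (a + b + 1) (by omega) hq (hT p hp) (by omega)
    · exact ih (a + b + 1) (by omega) (hS s hs) (hT' p hp) (by omega)

lemma algebraMap_mem_filt_one (c : k) : algebraMap k Q c ∈ (regular k Q).filt 1 := by
  rw [mem_filt_succ]
  intro φ hφ
  rw [mem_filt_zero, Algebra.algebraMap_eq_smul_one, map_smul]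
  apply smul_eq_zero_of_right
  apply act_eq_zero_of_coact_eq_tmul_one _ _ hφ
  exact Bialgebra.comul_one

end Unipotent

lemma AffineGroup.IsUnipotent.isConilpotent {k Q : Type*} [Field k] [CommRing Q] [HopfAlgebra k Q]
    (h : AffineGroup.IsUnipotent k Q) : IsConilpotent k Q := by
  obtain ⟨n, m, h1, h0, hΔ, -, hgen⟩ := h
  -- The entry `m i j` lies in step `j - i + 1` of the filtration.
  have hm : ∀ (d : ℕ) (i j : Fin n), (j : ℕ) < i + d →
      m i j ∈ (RightCoaction.regular k Q).filt d := by
    intro d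
    induction d with
    | zero =>
      intro i j hij
      rw [h0 i j (by simpa using hij)]
      exact zero_mem _
    | succ d ih =>
      intro i j hij
      rw [RightCoaction.mem_filt_succ]
      intro φ hφ
      rw [RightCoaction.act_apply]
      change tensorSlice Q φ (Coalgebra.comul (R := k) (m i j)) ∈ _
      rw [hΔ, map_sum]
      refine sum_mem fun l _ => ?_
      rw [tensorSlice_tmul]
      rcases lt_trichotomy l j with hlj | rfl | hlj
      · exact Submodule.smul_mem _ _ (ih i l (by have : (l : ℕ) < j := hlj; omega))
      · simp [h1, hφ]
      · simp [h0 l j hlj]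
  intro q
  have hq : q ∈ Algebra.adjoin k {a : Q | ∃ i j, a = m i j} := by rw [hgen]; trivial
  induction hq using Algebra.adjoin_induction with
  | mem x hx =>
    obtain ⟨i, j, rfl⟩ := hx
    exact ⟨j + 1, hm _ i j (by omega)⟩
  | algebraMap c => exact ⟨1, algebraMap_mem_filt_one c⟩
  | add x y _ _ hx hy =>
    obtain ⟨a, ha⟩ := hx
    obtain ⟨b, hb⟩ := hy
    exact ⟨max a b, add_mem (RightCoaction.filt_mono _ (le_max_left a b) ha)
      (RightCoaction.filt_mono _ (le_max_right a b) hb)⟩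
  | mul x y _ _ hx hy =>
    obtain ⟨a, ha⟩ := hx
    obtain ⟨b, hb⟩ := hy
    exact ⟨a + b, mul_mem_filt ha hb⟩

/-! ### Fixed vectors in extensions of unipotent groups -/

section Points

open WithConv

variable {k A R : Type*} [Field k] [CommRing A] [HopfAlgebra k A] [CommRing R] [Algebra k R]

/-- Points with values in any commutative algebra have left inverses. -/
lemma exists_convMul_eq_one (g : WithConv (A →ₐ[k] R)) :
    ∃ g' : WithConv (A →ₐ[k] R), g' * g = 1 := by
  refine ⟨toConv (g.ofConv.comp (HopfAlgebra.antipodeAlgHom k A)), ?_⟩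
  have h := AlgHom.comp_convMul_distrib g.ofConv
    (toConv (HopfAlgebra.antipodeAlgHom k A)) (toConv (AlgHom.id k A))
  rw [AlgHom.antipode_id_cancel] at h
  apply ofConv_injective
  refine h.symm.trans ?_
  ext a
  simp [AlgHom.convOne_def]

/-- Two points which agree on a quotient group `Spec Q` differ by a point of the kernel. -/
lemma exists_convMul_eq_of_comp_eq {Q : Type*} [CommRing Q] [HopfAlgebra k Q] {J : Ideal A}
    {π : Q →ₐc[k] A} (hJ : (RingHom.ker (Bialgebra.counitAlgHom k Q)).map (π : Q →ₐ[k] A) = J)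
    (g h : WithConv (A →ₐ[k] R))
    (hgh : g.ofConv.comp (π : Q →ₐ[k] A) = h.ofConv.comp (π : Q →ₐ[k] A)) :
    ∃ n : WithConv (A →ₐ[k] R), g * n = h ∧ ∀ a ∈ J, n.ofConv a = 0 := by
  obtain ⟨g', hg'⟩ := exists_convMul_eq_one g
  obtain ⟨g'', hg''⟩ := exists_convMul_eq_one g'
  have hgg' : g * g' = 1 := by
    have : g'' = g := by
      rw [← mul_one g'', ← hg', ← mul_assoc, hg'', one_mul]
    rw [← this, hg'']
  refine ⟨g' * h, by rw [← mul_assoc, hgg', one_mul], ?_⟩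
  have key : (g' * h).ofConv.comp (π : Q →ₐ[k] A) =
      (Algebra.ofId k R).comp (Bialgebra.counitAlgHom k Q) := by
    rw [AlgHom.convMul_comp_bialgHom_distrib, ← hgh, ← AlgHom.convMul_comp_bialgHom_distrib, hg']
    ext q
    simp [AlgHom.convOne_def]
  intro a ha
  rw [← hJ] at ha
  have hle : (RingHom.ker (Bialgebra.counitAlgHom k Q)).map (π : Q →ₐ[k] A) ≤
      RingHom.ker (g' * h).ofConv := by
    rw [Ideal.map_le_iff_le_comap]
    intro q hq
    have := DFunLike.congr_fun key q
    rw [RingHom.mem_ker] at hq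
    simp only [AlgHom.comp_apply, hq, map_zero] at this
    exact this
  exact hle ha

end Points

namespace RightCoaction

universe v w

variable {k : Type*} {B : Type v} {M : Type w} [Field k] [CommRing B] [HopfAlgebra k B]
  [AddCommGroup M] [Module k M]

/-- If a point `n` fixes `v`, then the points `g n` and `g` send `v` to the same vector. -/
lemma lTensor_convMul_coact {R : Type*} [CommRing R] [Algebra k R]
    (ρ : RightCoaction k B M) {v : M} (g n : WithConv (B →ₐ[k] R))
    (hn : n.ofConv.toLinearMap.lTensor M (ρ.coact v) = v ⊗ₜ 1) :
    (g * n).ofConv.toLinearMap.lTensor M (ρ.coact v) =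
      g.ofConv.toLinearMap.lTensor M (ρ.coact v) := by
  have h1 : (g * n).ofConv.toLinearMap =
      LinearMap.mul' k R ∘ₗ TensorProduct.map g.ofConv.toLinearMap n.ofConv.toLinearMap ∘ₗ
        Coalgebra.comul := rfl
  have h2 : ∀ t : M ⊗[k] B, (LinearMap.mul' k R ∘ₗ
      TensorProduct.map g.ofConv.toLinearMap n.ofConv.toLinearMap).lTensor M
        (TensorProduct.assoc k M B B (ρ.coact.rTensor B t)) =
      (LinearMap.mul' k R).lTensor M (TensorProduct.assoc k M R R
        ((g.ofConv.toLinearMap.lTensor M ∘ₗ ρ.coact).rTensor R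
          (n.ofConv.toLinearMap.lTensor M t))) := by
    intro t
    induction t with
    | zero => simp
    | add x y hx hy => simp only [map_add, hx, hy]
    | tmul x y =>
      simp only [LinearMap.rTensor_tmul, LinearMap.lTensor_tmul, LinearMap.comp_apply]
      generalize ρ.coact x = w
      induction w with
      | zero => simp
      | add x y hx hy => simp only [map_add, TensorProduct.add_tmul, hx, hy]
      | tmul x y => simp
  rw [h1, ← LinearMap.comp_assoc, LinearMap.lTensor_comp, LinearMap.comp_apply, ← ρ.coassoc, h2,
    hn]
  simp only [LinearMap.rTensor_tmul, LinearMap.comp_apply]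
  generalize g.ofConv.toLinearMap.lTensor M (ρ.coact v) = w
  induction w with
  | zero => simp
  | add x y hx hy => simp only [map_add, TensorProduct.add_tmul, hx, hy]
  | tmul x y => simp

/-- Faithfully flat descent: tensors over `B` on which both maps `B → B ⊗[Q] B` agree come
from `Q`. -/
lemma exists_sum_of_lTensor_eq {Q : Type*} [CommRing Q] [Algebra k Q] (f : Q →ₐ[k] B)
    (hf : (f : Q →+* B).FaithfullyFlat) (t : M ⊗[k] B)
    (ht : ∀ (R : Type v) [CommRing R] [Algebra k R] (g h : B →ₐ[k] R), g.comp f = h.comp f →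
      g.toLinearMap.lTensor M t = h.toLinearMap.lTensor M t) :
    ∃ (ι : Type w) (S : Finset ι) (a : ι → M) (q : ι → Q), t = ∑ i ∈ S, a i ⊗ₜ f (q i) := by
  classical
  let _ := (f : Q →+* B).toAlgebra
  have : IsScalarTower k Q B := IsScalarTower.of_algebraMap_eq'
    (by ext c; exact (f.commutes c).symm)
  have : Module.FaithfullyFlat Q B := hf
  let b := Module.Basis.ofVectorSpace k M
  have h := ht (B ⊗[Q] B) (Algebra.TensorProduct.includeLeft)
    ((Algebra.TensorProduct.includeRight : B →ₐ[Q] B ⊗[Q] B).restrictScalars k) (by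
      ext q
      change f q ⊗ₜ[Q] (1 : B) = 1 ⊗ₜ f q
      have : f q = q • (1 : B) := by rw [Algebra.smul_def, mul_one]; rfl
      rw [this, TensorProduct.smul_tmul])
  have hc : ∀ i, ∃ q, f q = TensorProduct.equivFinsuppOfBasisLeft b t i := by
    intro i
    apply (Algebra.IsEffective.of_faithfullyFlat Q B _).1
    have h' := congrArg (fun w => TensorProduct.equivFinsuppOfBasisLeft b w i) h
    simp only [TensorProduct.equivFinsuppOfBasisLeft_apply] at h' ⊢
    have hcomm : ∀ (g : B →ₗ[k] B ⊗[Q] B) (w : M ⊗[k] B),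
        TensorProduct.lid k (B ⊗[Q] B) ((b.coord i).rTensor (B ⊗[Q] B) (g.lTensor M w)) =
          g (TensorProduct.lid k B ((b.coord i).rTensor B w)) := by
      intro g w
      induction w with
      | zero => simp
      | add x y hx hy => simp only [map_add, hx, hy]
      | tmul x y => simp
    rw [hcomm, hcomm] at h'
    rw [Algebra.TensorProduct.includeLeftSubRight_apply, sub_eq_zero]
    exact h'
  choose q hq using hc
  refine ⟨_, (TensorProduct.equivFinsuppOfBasisLeft b t).support, b, q, ?_⟩
  conv_lhs => rw [← (TensorProduct.equivFinsuppOfBasisLeft b).symm_apply_apply t,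
    TensorProduct.equivFinsuppOfBasisLeft_symm_apply]
  simp only [hq]
  rfl

/-- If the group `Spec B` is an extension of a unipotent group by `V(J)`, then a representation
of `Spec B` with a nonzero vector fixed by `V(J)` has a nonzero fixed vector. -/
lemma exists_fixed_of_isQuotient {Q : Type*} [CommRing Q] [HopfAlgebra k Q]
    {J : Ideal B} {π : Q →ₐc[k] B} (hπ : AffineGroup.IsQuotient J π) (hQ : IsConilpotent k Q)
    (ρ : RightCoaction k B M) {v : M} (hv0 : v ≠ 0)
    (hv : (Ideal.Quotient.mkₐ k J).toLinearMap.lTensor M (ρ.coact v) = v ⊗ₜ 1) :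
    ∃ v', v' ≠ 0 ∧ ρ.coact v' = v' ⊗ₜ 1 := by
  obtain ⟨ι, S, a, q, hS⟩ := exists_sum_of_lTensor_eq (π : Q →ₐ[k] B) hπ.faithfullyFlat
    (ρ.coact v) (by
      intro R _ _ g h hgh
      obtain ⟨n, hn, hnJ⟩ := exists_convMul_eq_of_comp_eq hπ.kernel_eq
        (WithConv.toConv g) (WithConv.toConv h) hgh
      have hfix : n.ofConv.toLinearMap.lTensor M (ρ.coact v) = v ⊗ₜ 1 := by
        have : n.ofConv = (Ideal.Quotient.liftₐ J n.ofConv hnJ).comp (Ideal.Quotient.mkₐ k J) := by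
          ext; rfl
        rw [this, AlgHom.comp_toLinearMap, LinearMap.lTensor_comp, LinearMap.comp_apply, hv]
        simp
      have := ρ.lTensor_convMul_coact (WithConv.toConv g) n hfix
      rw [hn] at this
      exact this.symm)
  -- `v` is killed by a power of the augmentation ideal, as its coefficients come from `Q`.
  have hnil : ∀ (n : ℕ) (q : ι → Q), (∀ i ∈ S, q i ∈ (regular k Q).filt n) → ∀ v : M,
      ρ.coact v = ∑ i ∈ S, a i ⊗ₜ π (q i) → v ∈ ρ.filt n := by
    intro n
    induction n with
    | zero =>
      intro q hq v hv
      rw [mem_filt_zero, ← ρ.counit v, hv, Finset.sum_eq_zero, map_zero]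
      intro i hi
      simp [(mem_filt_zero _).1 (hq i hi)]
    | succ n ih =>
      intro q hq v hv
      rw [mem_filt_succ]
      intro φ hφ
      refine ih (fun i => (regular k Q).act (φ ∘ₗ (π : Q →ₗ[k] B)) (q i)) (fun i hi => ?_) _ ?_
      · exact (mem_filt_succ _).1 (hq i hi) _ (by simpa using hφ)
      · rw [coact_act, hv, map_sum]
        refine Finset.sum_congr rfl fun i _ => ?_
        rw [LinearMap.lTensor_tmul]
        congr 1
        rw [act_apply, act_apply]
        change tensorSlice B φ (Coalgebra.comul (π (q i))) =
          (π : Q →ₗ[k] B) (tensorSlice Q _ (Coalgebra.comul (q i)))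
        rw [← CoalgHomClass.map_comp_comul_apply, ← tensorSlice_rTensor, ← tensorSlice_lTensor]
        congr 1
        rw [← LinearMap.comp_apply (LinearMap.lTensor B _), LinearMap.lTensor_comp_rTensor]
  choose N hN using fun i => hQ (q i)
  exact ρ.exists_fixed_of_mem_filt _
    (hnil (S.sup N) q (fun i hi => filt_mono _ (Finset.le_sup hi) (hN i)) v hS) hv0

end RightCoaction

/-! ### Conilpotency of the coordinate ring of a pro-unipotent group -/

namespace RightCoaction

variable {k A M : Type*} [Field k] [CommRing A] [HopfAlgebra k A] [AddCommGroup M] [Module k M]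

/-- The vector `v` is fixed by the closed subgroup `V(I)`. -/
def FixedBy (ρ : RightCoaction k A M) (I : Ideal A) (v : M) : Prop :=
  (Ideal.Quotient.mkₐ k I).toLinearMap.lTensor M (ρ.coact v) = v ⊗ₜ 1

lemma FixedBy.exists_of_isQuotient {Q : Type*} [CommRing Q] [HopfAlgebra k Q] {I I' : Ideal A}
    [I.IsHopfIdeal k] {π : Q →ₐc[k] A ⧸ I}
    (hπ : AffineGroup.IsQuotient (I'.map (Ideal.Quotient.mk I)) π) (hQ : IsConilpotent k Q)
    (ρ : RightCoaction k A M) {v : M} (hv0 : v ≠ 0) (hv : ρ.FixedBy I' v) :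
    ∃ v', v' ≠ 0 ∧ ρ.FixedBy I v' := by
  refine exists_fixed_of_isQuotient hπ hQ (ρ.restrict (Bialgebra.Quotient.mkBialgHom I)) hv0 ?_
  let g : A ⧸ I' →ₐ[k] (A ⧸ I) ⧸ I'.map (Ideal.Quotient.mk I) :=
    Ideal.Quotient.liftₐ I'
      ((Ideal.Quotient.mkₐ k (I'.map (Ideal.Quotient.mk I))).comp (Ideal.Quotient.mkₐ k I))
      (fun a ha => Ideal.Quotient.eq_zero_iff_mem.2 (Ideal.mem_map_of_mem _ ha))
  have h := congrArg (g.toLinearMap.lTensor M) hv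
  rw [← LinearMap.comp_apply, ← LinearMap.lTensor_comp] at h
  have h1 : g.toLinearMap.lTensor M (v ⊗ₜ[k] (1 : A ⧸ I')) = v ⊗ₜ 1 := by simp
  rw [h1] at h
  rw [← h]
  change LinearMap.lTensor M _ (LinearMap.lTensor M _ _) = _
  rw [← LinearMap.comp_apply, ← LinearMap.lTensor_comp]
  rfl

lemma FixedBy.coact_eq {ρ : RightCoaction k A M} {v : M} (hv : ρ.FixedBy ⊥ v) :
    ρ.coact v = v ⊗ₜ 1 := by
  have h := congrArg ((Ideal.Quotient.liftₐ (⊥ : Ideal A) (AlgHom.id k A)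
    (fun a ha => ha)).toLinearMap.lTensor M) hv
  rw [← LinearMap.comp_apply, ← LinearMap.lTensor_comp] at h
  simp only [LinearMap.lTensor_tmul, AlgHom.toLinearMap_apply, map_one] at h
  rw [← h]
  refine (LinearMap.lTensor_id_apply M A _).symm.trans ?_
  rfl

end RightCoaction

open RightCoaction in
/-- A limit of successive extensions of unipotent groups is pro-unipotent. Otherwise the functions
on the group, modulo those on which it acts unipotently, would form a nonzero representation; a
function on `U / V(I j)` gives a vector in it fixed by `V(I j)`, from which one fixed by
the whole group can be deduced, a contradiction. -/
theorem isConilpotent_of_tower {k A : Type*} [Field k] [CommRing A] [HopfAlgebra k A]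
    (I : ℕ → Ideal A) [∀ i, (I i).IsHopfIdeal k] (hI_zero : I 0 = ⊥)
    (hI_lim : AffineGroup.IsLimitOfQuotients k I)
    (Q : ℕ → Type*) [∀ i, CommRing (Q i)] [∀ i, HopfAlgebra k (Q i)]
    (π : ∀ i, Q i →ₐc[k] A ⧸ I i)
    (hπ : ∀ i, AffineGroup.IsQuotient ((I (i + 1)).map (Ideal.Quotient.mk (I i))) (π i))
    (hQ : ∀ i, IsConilpotent k (Q i)) : IsConilpotent k A := by
  set ρ := regular k A
  set F : Submodule k A := ⨆ n, ρ.filt n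
  have hmemF : ∀ a, a ∈ F ↔ ∃ n, a ∈ ρ.filt n := fun a =>
    Submodule.mem_iSup_of_directed _ ρ.filt_mono.directed_le
  have hF : ∀ a ∈ F, ∀ φ : A →ₗ[k] k, ρ.act φ a ∈ F := by
    intro a ha φ
    obtain ⟨n, hn⟩ := (hmemF a).1 ha
    exact (hmemF _).2 ⟨n, ρ.act_mem_filt hn φ⟩
  classical
  by_contra hcon
  obtain ⟨a, ha⟩ : ∃ a, a ∉ F := by
    by_contra! h
    exact hcon fun a => (hmemF a).1 (h a)
  have descend : ∀ (j : ℕ) (v : A ⧸ F), v ≠ 0 → (ρ.quotient F hF).FixedBy (I j) v →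
      ∃ v', v' ≠ 0 ∧ (ρ.quotient F hF).FixedBy (I 0) v' := by
    intro j
    induction j with
    | zero => exact fun v hv0 hv => ⟨v, hv0, hv⟩
    | succ j ih =>
      intro v hv0 hv
      obtain ⟨v', hv0', hv'⟩ := FixedBy.exists_of_isQuotient (hπ j) (hQ j) _ hv0 hv
      exact ih v' hv0' hv'
  obtain ⟨j, hj⟩ := hI_lim a
  obtain ⟨v', hv0', hv'⟩ := descend j (F.mkQ a)
    (by rwa [Submodule.mkQ_apply, Ne, Submodule.Quotient.mk_eq_zero]) (by
      have h1 : (Ideal.Quotient.mkₐ k (I j)).toLinearMap.lTensor A (ρ.coact a) = a ⊗ₜ 1 := hj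
      have h2 := congrArg (F.mkQ.rTensor (A ⧸ I j)) h1
      rw [← LinearMap.comp_apply, LinearMap.rTensor_comp_lTensor,
        ← LinearMap.lTensor_comp_rTensor] at h2
      exact h2)
  rw [hI_zero] at hv'
  obtain ⟨b, rfl⟩ := F.mkQ_surjective v'
  have hact : ∀ φ : A →ₗ[k] k, φ 1 = 0 → ρ.act φ b ∈ F := by
    intro φ hφ
    have h := act_eq_zero_of_coact_eq_tmul_one _ hv'.coact_eq hφ
    rw [← Submodule.Quotient.mk_eq_zero, ← Submodule.mkQ_apply]
    refine Eq.trans ?_ h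
    exact (tensorSlice_rTensor F.mkQ φ (ρ.coact b)).symm
  -- The vectors `φ · b` span a finite-dimensional space, so one step of the filtration
  -- contains all those with `φ 1 = 0`.
  obtain ⟨S, hS⟩ := TensorProduct.exists_finset (ρ.coact b)
  let E : Submodule k A := Submodule.span k (S.image Prod.fst : Finset A)
  have hE : ∀ φ : A →ₗ[k] k, ρ.act φ b ∈ E := by
    intro φ
    rw [act_apply, hS, map_sum]
    refine sum_mem fun p hp => ?_
    rw [tensorSlice_tmul]
    exact Submodule.smul_mem _ _ (Submodule.subset_span (Finset.mem_coe.2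
      (Finset.mem_image_of_mem _ hp)))
  have : FiniteDimensional k E := FiniteDimensional.span_finset k _
  have : FiniteDimensional k (E ⊓ F : Submodule k A) := Submodule.finiteDimensional_inf_left E F
  obtain ⟨T, hT⟩ := (Submodule.fg_iff_finiteDimensional (E ⊓ F)).2 this
  have hTF : ∀ t ∈ T, ∃ n, t ∈ ρ.filt n := by
    intro t ht
    have : t ∈ E ⊓ F := by rw [← hT]; exact Submodule.subset_span ht
    exact (hmemF t).1 this.2
  choose! N hN using hTF
  have hle : E ⊓ F ≤ ρ.filt (T.sup N) := by
    rw [← hT, Submodule.span_le]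
    exact fun t ht => ρ.filt_mono (Finset.le_sup ht) (hN t ht)
  apply hv0'
  rw [Submodule.mkQ_apply, Submodule.Quotient.mk_eq_zero, hmemF]
  exact ⟨T.sup N + 1, ρ.mem_filt_succ.2 fun φ hφ => hle ⟨hE φ, hact φ hφ⟩⟩

/-! ### Groups of unitriangular matrices -/

section Unitriangular

variable {n : ℕ} {k : Type*} [Field k]

/-- The matrices whose entries vanish below the `r`-th superdiagonal. -/
def superdiagonal (n : ℕ) (k : Type*) [Field k] (r : ℕ) :
    Submodule k (Matrix (Fin n) (Fin n) k) where
  carrier := {M | ∀ i j : Fin n, (j : ℕ) < i + r → M i j = 0}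
  add_mem' ha hb i j h := by simp [ha i j h, hb i j h]
  zero_mem' i j _ := rfl
  smul_mem' c M hM i j h := by simp [hM i j h]

lemma superdiagonal_anti {r s : ℕ} (h : r ≤ s) : superdiagonal n k s ≤ superdiagonal n k r :=
  fun _ hM i j hij => hM i j (by omega)

lemma mul_mem_superdiagonal {r s : ℕ} {M N : Matrix (Fin n) (Fin n) k}
    (hM : M ∈ superdiagonal n k r) (hN : N ∈ superdiagonal n k s) :
    M * N ∈ superdiagonal n k (r + s) := by
  intro i j hij
  rw [Matrix.mul_apply]
  refine Finset.sum_eq_zero fun l _ => ?_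
  by_cases h : (l : ℕ) < i + r
  · rw [hM i l h, zero_mul]
  · rw [hN l j (by omega), mul_zero]

lemma eq_zero_of_mem_superdiagonal {M : Matrix (Fin n) (Fin n) k}
    (hM : M ∈ superdiagonal n k n) : M = 0 := by
  ext i j
  exact hM i j (by omega)

lemma one_mem_superdiagonal : (1 : Matrix (Fin n) (Fin n) k) ∈ superdiagonal n k 0 := by
  intro i j hij
  exact Matrix.one_apply_ne (by rintro rfl; omega)

lemma mem_superdiagonal_zero_of_sub_one {M : Matrix (Fin n) (Fin n) k}
    (hM : M - 1 ∈ superdiagonal n k 1) : M ∈ superdiagonal n k 0 := by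
  have := add_mem (superdiagonal_anti (Nat.zero_le 1) hM) one_mem_superdiagonal
  simpa using this

variable {G : Type*} [Group G] (ψ : G →* Matrix (Fin n) (Fin n) k)

/-- The elements of `G` which act as the identity up to the `r`-th superdiagonal. -/
def unitriangularFiltration (hψ : ∀ g, ψ g - 1 ∈ superdiagonal n k 1) (r : ℕ) : Subgroup G where
  carrier := {g | ψ g - 1 ∈ superdiagonal n k (r + 1)}
  one_mem' := by simp
  mul_mem' {a b} ha hb := by
    have h : ψ (a * b) - 1 = (ψ a - 1) * ψ b + (ψ b - 1) := by rw [map_mul]; noncomm_ring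
    rw [Set.mem_ofPred_eq, h]
    exact add_mem (mul_mem_superdiagonal (s := 0) ha
      (mem_superdiagonal_zero_of_sub_one (hψ b))) hb
  inv_mem' {a} ha := by
    have h1 : ψ a * ψ a⁻¹ = 1 := by rw [← map_mul, mul_inv_cancel, map_one]
    have h : ψ a⁻¹ - 1 = -((ψ a - 1) * ψ a⁻¹) := by rw [sub_mul, h1]; noncomm_ring
    rw [Set.mem_ofPred_eq, h]
    exact neg_mem (mul_mem_superdiagonal (s := 0) ha
      (mem_superdiagonal_zero_of_sub_one (hψ _)))

lemma mem_unitriangularFiltration {hψ : ∀ g, ψ g - 1 ∈ superdiagonal n k 1} {r : ℕ} {g : G} :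
    g ∈ unitriangularFiltration ψ hψ r ↔ ψ g - 1 ∈ superdiagonal n k (r + 1) := Iff.rfl

open scoped commutatorElement in
lemma isNilpotent_of_unitriangular (hinj : Function.Injective ψ)
    (hψ : ∀ g, ψ g - 1 ∈ superdiagonal n k 1) : Group.IsNilpotent G := by
  rw [Subgroup.nilpotent_iff_finite_descending_central_series]
  refine ⟨n, unitriangularFiltration ψ hψ, ⟨?_, ?_⟩, ?_⟩
  · rw [eq_top_iff]
    exact fun g _ => hψ g
  · intro x r hx g
    rw [mem_unitriangularFiltration] at hx ⊢
    have h1 : ψ g * ψ x * (ψ x⁻¹ * ψ g⁻¹) = 1 := by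
      rw [← map_mul, ← map_mul, ← map_mul]; simp
    have h : ψ ⁅x, g⁆ - 1 =
        ((ψ x - 1) * (ψ g - 1) - (ψ g - 1) * (ψ x - 1)) * (ψ x⁻¹ * ψ g⁻¹) := by
      have h2 : (ψ x - 1) * (ψ g - 1) - (ψ g - 1) * (ψ x - 1) = ψ x * ψ g - ψ g * ψ x := by
        noncomm_ring
      rw [h2, sub_mul, h1, commutatorElement_def]
      simp only [map_mul, mul_assoc]
    rw [h]
    refine mul_mem_superdiagonal (s := 0)
      (sub_mem (mul_mem_superdiagonal (r := r + 1) hx (hψ g)) ?_)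
      (mul_mem_superdiagonal (r := 0) (mem_superdiagonal_zero_of_sub_one (hψ _))
        (mem_superdiagonal_zero_of_sub_one (hψ _)))
    rw [add_comm (r + 1) 1]
    exact mul_mem_superdiagonal (hψ g) hx
  · rw [eq_bot_iff]
    intro g hg
    rw [mem_unitriangularFiltration] at hg
    apply hinj
    rw [map_one, ← sub_eq_zero]
    exact eq_zero_of_mem_superdiagonal (superdiagonal_anti n.le_succ hg)

/-- If unitriangular matrices `X` and `Y` agree below the `r`-th superdiagonal, then `Y ^ m - X ^ m`
and `m • (Y - X)` agree on it as well. -/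
lemma pow_sub_pow_sub_mem_superdiagonal {r : ℕ} {X Y : Matrix (Fin n) (Fin n) k}
    (hX : X - 1 ∈ superdiagonal n k 1) (hY : Y - 1 ∈ superdiagonal n k 1)
    (h : Y - X ∈ superdiagonal n k r) (m : ℕ) :
    Y ^ m - X ^ m - (m : k) • (Y - X) ∈ superdiagonal n k (r + 1) := by
  have hX0 := mem_superdiagonal_zero_of_sub_one hX
  have hpow : ∀ m : ℕ, X ^ m - 1 ∈ superdiagonal n k 1 := by
    intro m
    induction m with
    | zero => simp
    | succ m ih =>
      have : X ^ (m + 1) - 1 = (X ^ m - 1) * X + (X - 1) := by rw [pow_succ]; noncomm_ring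
      rw [this]
      exact add_mem (mul_mem_superdiagonal (s := 0) ih hX0) hX
  induction m with
  | zero => simp
  | succ m ih =>
    have key : Y ^ (m + 1) - X ^ (m + 1) - ((m + 1 : ℕ) : k) • (Y - X) =
        (Y ^ m - X ^ m - (m : k) • (Y - X)) +
          ((Y - 1) * (Y ^ m - X ^ m - (m : k) • (Y - X)) + (m : k) • ((Y - 1) * (Y - X))) +
          (Y - X) * (X ^ m - 1) := by
      rw [Nat.cast_add, Nat.cast_one, add_smul, one_smul, pow_succ' Y, pow_succ' X,
        ← mul_smul_comm]
      noncomm_ring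
    rw [key]
    refine add_mem (add_mem ih (add_mem ?_ (Submodule.smul_mem _ _ ?_))) ?_
    · exact superdiagonal_anti (by omega) (mul_mem_superdiagonal hY ih)
    · exact superdiagonal_anti (by omega) (mul_mem_superdiagonal hY h)
    · exact mul_mem_superdiagonal h (hpow m)

lemma pow_injective_of_unitriangular (hinj : Function.Injective ψ)
    (hψ : ∀ g, ψ g - 1 ∈ superdiagonal n k 1) {m : ℕ} (hm : (m : k) ≠ 0) :
    Function.Injective fun g : G => g ^ m := by
  intro x y hxy
  have hxy' : ψ x ^ m = ψ y ^ m := by rw [← map_pow, ← map_pow]; exact congrArg ψ hxy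
  have h : ∀ r, ψ y - ψ x ∈ superdiagonal n k r := by
    intro r
    induction r with
    | zero =>
      exact sub_mem (mem_superdiagonal_zero_of_sub_one (hψ y))
        (mem_superdiagonal_zero_of_sub_one (hψ x))
    | succ r ih =>
      have h1 := pow_sub_pow_sub_mem_superdiagonal (hψ x) (hψ y) ih m
      rw [hxy', sub_self, zero_sub] at h1
      have h2 := Submodule.smul_mem _ (-(m : k)⁻¹) h1
      rwa [smul_neg, neg_smul, neg_neg, smul_smul, inv_mul_cancel₀ hm, one_smul] at h2
  exact (hinj (sub_eq_zero.1 (eq_zero_of_mem_superdiagonal (h n)))).symm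

/-- In characteristic `p`, unitriangular matrices have order a power of `p`, so that every
one of them is an `m`-th power for each `m` prime to `p`. -/
lemma pow_surjective_of_unitriangular_of_charP (hinj : Function.Injective ψ)
    (hψ : ∀ g, ψ g - 1 ∈ superdiagonal n k 1) (p : ℕ) [Fact p.Prime] [CharP k p] {m : ℕ}
    (hm : (m : k) ≠ 0) : Function.Surjective fun g : G => g ^ m := by
  have hexp : ∀ g : G, g ^ p ^ n = 1 := by
    intro g
    apply hinj
    rw [map_pow, map_one, ← sub_eq_zero]
    rcases Nat.eq_zero_or_pos n with rfl | hn
    · exact Subsingleton.elim _ _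
    have : Nonempty (Fin n) := ⟨⟨0, hn⟩⟩
    have h1 : ψ g ^ p ^ n - 1 = (ψ g - 1) ^ p ^ n := by
      rw [sub_pow_char_pow_of_commute _ _ (Commute.one_right _), one_pow]
    have h2 : ∀ r, (ψ g - 1) ^ r ∈ superdiagonal n k r := by
      intro r
      induction r with
      | zero => simpa using one_mem_superdiagonal
      | succ r ih => rw [pow_succ]; exact mul_mem_superdiagonal ih (hψ g)
    rw [h1]
    exact eq_zero_of_mem_superdiagonal
      (superdiagonal_anti (Nat.lt_pow_self (Fact.out : p.Prime).one_lt).le (h2 _))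
  have hcop : Nat.Coprime m (p ^ n) := by
    refine Nat.Coprime.pow_right _ (Nat.Coprime.symm ?_)
    rw [(Fact.out : p.Prime).coprime_iff_not_dvd]
    rwa [Ne, CharP.cast_eq_zero_iff k p] at hm
  intro g
  -- Bézout: `m u + pⁿ v = 1`.
  refine ⟨g ^ (m.gcdA (p ^ n)), ?_⟩
  have hb := Nat.gcd_eq_gcd_ab m (p ^ n)
  rw [hcop.gcd_eq_one] at hb
  have h3 : g ^ ((1 : ℕ) : ℤ) = g := by simp
  conv_rhs => rw [← h3, hb, zpow_add, zpow_mul, zpow_mul]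
  simp only [zpow_natCast]
  rw [hexp, one_zpow, mul_one, ← zpow_natCast, ← zpow_natCast, ← zpow_mul, ← zpow_mul, mul_comm]

end Unitriangular

/-! ### Vanishing of non-abelian cohomology -/

section Cohomology

variable {Γ G : Type*} [Group Γ] [Group G]

/-- The cocycle `s ↦ g⁻¹ · c s · ˢg`, cohomologous to `c`. -/
def OneCocycle.twist {φ : Γ →* MulAut G} (c : OneCocycle φ) (g : G) : OneCocycle φ where
  toFun s := g⁻¹ * c.toFun s * φ s g
  map_mul' s t := by
    rw [c.map_mul', map_mul φ]
    simp [mul_assoc]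

/-- The action induced on the quotient by a stable normal subgroup. -/
def MulAut.quotientHom (φ : Γ →* MulAut G) (N : Subgroup G) [N.Normal]
    (hN : ∀ s, ∀ x ∈ N, φ s x ∈ N) : Γ →* MulAut (G ⧸ N) where
  toFun s :=
    { toFun := QuotientGroup.map N N (φ s : G →* G) (hN s)
      invFun := QuotientGroup.map N N (φ s⁻¹ : G →* G) (hN s⁻¹)
      left_inv := by
        intro x
        obtain ⟨x, rfl⟩ := QuotientGroup.mk_surjective x
        exact congrArg _ (by simp : φ s⁻¹ (φ s x) = x)
      right_inv := by
        intro x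
        obtain ⟨x, rfl⟩ := QuotientGroup.mk_surjective x
        exact congrArg _ (by simp : φ s (φ s⁻¹ x) = x)
      map_mul' := map_mul _ }
  map_one' := by
    ext x
    obtain ⟨x, rfl⟩ := QuotientGroup.mk_surjective x
    exact congrArg _ (by simp : φ 1 x = x)
  map_mul' s t := by
    ext x
    obtain ⟨x, rfl⟩ := QuotientGroup.mk_surjective x
    exact congrArg _ (by simp : φ (s * t) x = φ s (φ t x))

lemma MulAut.quotientHom_mk (φ : Γ →* MulAut G) (N : Subgroup G) [N.Normal]
    (hN : ∀ s, ∀ x ∈ N, φ s x ∈ N) (s : Γ) (x : G) :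
    MulAut.quotientHom φ N hN s (x : G ⧸ N) = ((φ s x : G) : G ⧸ N) := rfl

/-- The action induced on a stable subgroup. -/
def MulAut.restrictHom (φ : Γ →* MulAut G) (N : Subgroup G)
    (hN : ∀ s, ∀ x ∈ N, φ s x ∈ N) : Γ →* MulAut N where
  toFun s :=
    { toFun := fun x => ⟨φ s x, hN s x x.2⟩
      invFun := fun x => ⟨φ s⁻¹ x, hN s⁻¹ x x.2⟩
      left_inv := fun x => by ext; simp
      right_inv := fun x => by ext; simp
      map_mul' := fun x y => by ext; simp }
  map_one' := by ext; simp
  map_mul' s t := by ext; simp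

lemma OneCocycle.exists_twist_mem {φ : Γ →* MulAut G} (N : Subgroup G) [N.Normal]
    (hN : ∀ s, ∀ x ∈ N, φ s x ∈ N)
    (h : ∀ c : OneCocycle (MulAut.quotientHom φ N hN), ∃ g, ∀ s, (c.twist g).toFun s = 1)
    (c : OneCocycle φ) : ∃ g, ∀ s, (c.twist g).toFun s ∈ N := by
  obtain ⟨g, hg⟩ := h
    { toFun := fun s => (c.toFun s : G ⧸ N)
      map_mul' := fun s t => by
        rw [c.map_mul', MulAut.quotientHom_mk]; rfl }
  obtain ⟨g, rfl⟩ := QuotientGroup.mk_surjective g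
  refine ⟨g, fun s => ?_⟩
  rw [← QuotientGroup.eq_one_iff]
  exact hg s

lemma MulAut.apply_mem_center (φ : Γ →* MulAut G) (s : Γ) (x : G)
    (hx : x ∈ Subgroup.center G) : φ s x ∈ Subgroup.center G := by
  rw [Subgroup.mem_center_iff] at hx ⊢
  intro g
  have := congrArg (φ s) (hx ((φ s).symm g))
  simpa using this

/-- Where `m`-th roots are unique, those of central elements are central. -/
lemma mem_center_of_pow_mem_center {m : ℕ} (hinj : Function.Injective fun x : G => x ^ m) {w : G}
    (hw : w ^ m ∈ Subgroup.center G) : w ∈ Subgroup.center G := by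
  rw [Subgroup.mem_center_iff]
  intro g
  have h1 : (g * w * g⁻¹) ^ m = w ^ m := by
    rw [conj_pow, Subgroup.mem_center_iff.1 hw g, mul_inv_cancel_right]
  exact mul_inv_eq_iff_eq_mul.1 (hinj h1)

open scoped IsMulCommutative in
/-- The averaging argument: a cocycle with values in the centre is trivial as soon as
`x ↦ x ^ |Γ|` is bijective. -/
lemma OneCocycle.exists_twist_eq_one_of_mem_center [Finite Γ] {φ : Γ →* MulAut G}
    (hb : Function.Bijective fun x : G => x ^ Nat.card Γ) (c : OneCocycle φ)
    (hc : ∀ s, c.toFun s ∈ Subgroup.center G) : ∃ g, ∀ s, (c.twist g).toFun s = 1 := by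
  have := Fintype.ofFinite Γ
  have hφ := MulAut.apply_mem_center φ
  let c' : Γ → Subgroup.center G := fun s => ⟨c.toFun s, hc s⟩
  let φ' := MulAut.restrictHom φ (Subgroup.center G) hφ
  have hc' : ∀ s t, c' (s * t) = c' s * φ' s (c' t) := fun s t => Subtype.ext (c.map_mul' s t)
  let z : Subgroup.center G := ∏ t, c' t
  have hz : ∀ s, z = c' s ^ Nat.card Γ * φ' s z := by
    intro s
    calc z = ∏ t, c' (s * t) := (Fintype.prod_equiv (Equiv.mulLeft s) _ _ fun t => rfl).symm
      _ = ∏ t, (c' s * φ' s (c' t)) := by simp only [hc']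
      _ = c' s ^ Nat.card Γ * φ' s z := by
        rw [Finset.prod_mul_distrib, map_prod, Finset.prod_const, Finset.card_univ,
          Nat.card_eq_fintype_card]
  obtain ⟨w, hw⟩ := hb.2 (z : G)
  simp only at hw
  have hwc : w ∈ Subgroup.center G := mem_center_of_pow_mem_center hb.1 (hw ▸ z.2)
  refine ⟨w, fun s => ?_⟩
  apply hb.1
  have hcomm : ∀ x : G, Commute w⁻¹ x := fun x =>
    (Subgroup.mem_center_iff.1 (inv_mem hwc) x).symm
  have hcomm' : Commute (w⁻¹ * c.toFun s) (φ s w) :=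
    Subgroup.mem_center_iff.1 (hφ s w hwc) _
  change (w⁻¹ * c.toFun s * φ s w) ^ Nat.card Γ = 1 ^ Nat.card Γ
  rw [one_pow, hcomm'.mul_pow, (hcomm _).mul_pow, ← map_pow, hw, inv_pow, hw]
  have h3 : (z : G) = c.toFun s ^ Nat.card Γ * φ s z := congrArg Subtype.val (hz s)
  rw [mul_assoc, ← h3, inv_mul_cancel]

/-- Cocycles of a finite group `Γ` in a nilpotent group on which `x ↦ x ^ |Γ|` is bijective
are trivial. -/
theorem OneCocycle.exists_twist_eq_one_of_isNilpotent [Finite Γ] [Group.IsNilpotent G]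
    (hb : Function.Bijective fun x : G => x ^ Nat.card Γ) (φ : Γ →* MulAut G)
    (c : OneCocycle φ) : ∃ g, ∀ s, (c.twist g).toFun s = 1 := by
  revert hb φ c
  refine Group.nilpotent_center_quotient_ind (P := fun G _ _ =>
    (Function.Bijective fun x : G => x ^ Nat.card Γ) → ∀ (φ : Γ →* MulAut G) (c : OneCocycle φ),
      ∃ g, ∀ s, (c.twist g).toFun s = 1) G ?_ ?_
  · intro G _ _ _ φ c
    exact ⟨1, fun s => Subsingleton.elim _ _⟩
  · intro G _ _ ih hb φ c
    have hφ := MulAut.apply_mem_center φ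
    have hb' : Function.Bijective fun x : G ⧸ Subgroup.center G => x ^ Nat.card Γ := by
      constructor
      · intro x y hxy
        obtain ⟨x, rfl⟩ := QuotientGroup.mk_surjective x
        obtain ⟨y, rfl⟩ := QuotientGroup.mk_surjective y
        -- `yᵐ = xᵐ wᵐ` with `w` central, so that `y = x w`.
        have hz : (x ^ Nat.card Γ)⁻¹ * y ^ Nat.card Γ ∈ Subgroup.center G :=
          QuotientGroup.eq.1 hxy
        obtain ⟨w, hw⟩ := hb.2 ((x ^ Nat.card Γ)⁻¹ * y ^ Nat.card Γ)
        simp only at hw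
        have hwc : w ∈ Subgroup.center G := mem_center_of_pow_mem_center hb.1 (hw ▸ hz)
        have h3 : x * w = y := by
          apply hb.1
          have hcomm : Commute x w := Subgroup.mem_center_iff.1 hwc x
          change (x * w) ^ Nat.card Γ = y ^ Nat.card Γ
          rw [hcomm.mul_pow, hw, mul_inv_cancel_left]
        rw [← h3]
        exact QuotientGroup.eq.2 (by simpa using hwc)
      · intro x
        obtain ⟨x, rfl⟩ := QuotientGroup.mk_surjective x
        obtain ⟨y, rfl⟩ := hb.2 x
        exact ⟨(y : G ⧸ Subgroup.center G), rfl⟩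
    obtain ⟨g, hg⟩ := c.exists_twist_mem (Subgroup.center G) hφ (ih hb' _)
    obtain ⟨h, hh⟩ := OneCocycle.exists_twist_eq_one_of_mem_center hb (c.twist g) hg
    refine ⟨g * h, fun s => ?_⟩
    rw [← hh s]
    simp [OneCocycle.twist, mul_assoc]

/-- If `N / N'` embeds in a group of unitriangular matrices over a field in which `|Γ|` is
invertible, and if elements of `N` have `|Γ|`-th roots in characteristic zero, then a cocycle
in `N` is cohomologous to one in `N'`. -/
lemma OneCocycle.exists_twist_mem_of_unitriangular [Finite Γ] {φ : Γ →* MulAut G}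
    (N N' : Subgroup G) (hN : ∀ s, ∀ x ∈ N, φ s x ∈ N) (hN' : ∀ s, ∀ x ∈ N', φ s x ∈ N')
    {k : Type*} [Field k] {n : ℕ} (ψ : N →* Matrix (Fin n) (Fin n) k)
    (hψ : ∀ x, ψ x - 1 ∈ superdiagonal n k 1) (hker : ψ.ker = N'.subgroupOf N)
    (hΓ : (Nat.card Γ : k) ≠ 0)
    (hroot : CharZero k → ∀ x ∈ N, ∃ y ∈ N, y ^ Nat.card Γ = x)
    (c : OneCocycle φ) (hc : ∀ s, c.toFun s ∈ N) :
    ∃ g ∈ N, ∀ s, (c.twist g).toFun s ∈ N' := by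
  have hmem : ∀ x, x ∈ ψ.ker ↔ (x : G) ∈ N' := by
    intro x; rw [hker, Subgroup.mem_subgroupOf]
  let ψ' : N ⧸ ψ.ker →* Matrix (Fin n) (Fin n) k := QuotientGroup.lift ψ.ker ψ le_rfl
  have hinj : Function.Injective ψ' := by
    intro x y hxy
    obtain ⟨x, rfl⟩ := QuotientGroup.mk_surjective x
    obtain ⟨y, rfl⟩ := QuotientGroup.mk_surjective y
    have hxy' : ψ x = ψ y := hxy
    rw [QuotientGroup.eq, MonoidHom.mem_ker, map_mul, ← hxy', ← map_mul, inv_mul_cancel, map_one]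
  have hψ' : ∀ g, ψ' g - 1 ∈ superdiagonal n k 1 := by
    intro g
    obtain ⟨g, rfl⟩ := QuotientGroup.mk_surjective g
    exact hψ g
  have hnil := isNilpotent_of_unitriangular ψ' hinj hψ'
  have hsurj : Function.Surjective fun g : N ⧸ ψ.ker => g ^ Nat.card Γ := by
    obtain ⟨p, hp⟩ := CharP.exists k
    rcases CharP.char_is_prime_or_zero k p with hprime | rfl
    · have : Fact p.Prime := ⟨hprime⟩
      exact pow_surjective_of_unitriangular_of_charP ψ' hinj hψ' p hΓ
    · intro g
      obtain ⟨x, rfl⟩ := QuotientGroup.mk_surjective g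
      obtain ⟨y, hyN, hy⟩ := hroot (CharP.charP_to_charZero k) x x.2
      have hyx : (⟨y, hyN⟩ : N) ^ Nat.card Γ = x := Subtype.ext hy
      refine ⟨QuotientGroup.mk' ψ.ker ⟨y, hyN⟩, ?_⟩
      rw [← QuotientGroup.mk'_apply, ← hyx, map_pow]
  let c' : OneCocycle (MulAut.restrictHom φ N hN) :=
    { toFun := fun s => ⟨c.toFun s, hc s⟩
      map_mul' := fun s t => Subtype.ext (c.map_mul' s t) }
  have hstable : ∀ s, ∀ x ∈ ψ.ker, MulAut.restrictHom φ N hN s x ∈ ψ.ker := by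
    intro s x hx
    rw [hmem] at hx ⊢
    exact hN' s x hx
  obtain ⟨g, hg⟩ := c'.exists_twist_mem ψ.ker hstable
    (OneCocycle.exists_twist_eq_one_of_isNilpotent
      ⟨pow_injective_of_unitriangular ψ' hinj hψ' hΓ, hsurj⟩ _)
  exact ⟨g, g.2, fun s => (hmem _).1 (hg s)⟩

/-- Cocycles in a group which is complete for a stable filtration are trivial if those in the
successive quotients are. -/
theorem OneCocycle.exists_twist_eq_one_of_filtration {φ : Γ →* MulAut G} (N : ℕ → Subgroup G)
    (hN0 : N 0 = ⊤) (hφ : ∀ i s, ∀ x ∈ N i, φ s x ∈ N i)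
    (hsep : ∀ x, (∀ i, x ∈ N i) → x = 1)
    (hcomplete : ∀ x : ℕ → G, (∀ i, (x i)⁻¹ * x (i + 1) ∈ N i) →
      ∃ y, ∀ i, (x i)⁻¹ * y ∈ N i)
    (hgr : ∀ (i : ℕ) (c : OneCocycle φ), (∀ s, c.toFun s ∈ N i) →
      ∃ g ∈ N i, ∀ s, (c.twist g).toFun s ∈ N (i + 1))
    (c : OneCocycle φ) : ∃ g, ∀ s, (c.twist g).toFun s = 1 := by
  have htwist : ∀ g h : G, (c.twist g).twist h = c.twist (g * h) := by
    intro g h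
    simp [OneCocycle.twist, mul_assoc]
  have hstep : ∀ i g, (∀ s, (c.twist g).toFun s ∈ N i) →
      ∃ g', g⁻¹ * g' ∈ N i ∧ ∀ s, (c.twist g').toFun s ∈ N (i + 1) := by
    intro i g hg
    obtain ⟨h, hh, hh'⟩ := hgr i _ hg
    refine ⟨g * h, by simpa using hh, ?_⟩
    rwa [htwist] at hh'
  choose! next hnext hnext' using hstep
  let x : ℕ → G := fun i => Nat.rec 1 (fun i g => next i g) i
  have hx : ∀ i s, (c.twist (x i)).toFun s ∈ N i := by
    intro i
    induction i with
    | zero => intro s; rw [hN0]; trivial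
    | succ i ih => exact hnext' i (x i) ih
  obtain ⟨y, hy⟩ := hcomplete x fun i => hnext i (x i) (hx i)
  refine ⟨y, fun s => hsep _ fun i => ?_⟩
  have h : y = x i * ((x i)⁻¹ * y) := by group
  rw [h, ← htwist]
  exact mul_mem (mul_mem (inv_mem (hy i)) (hx i s)) (hφ i s _ (hy i))

end Cohomology

/-! ### Functoriality of points -/

section Functoriality

open WithConv

variable {k A B R S : Type*} [Field k] [CommRing A] [Bialgebra k A] [CommRing B] [Bialgebra k B]
  [CommRing R] [Algebra k R] [CommRing S] [Algebra k S]

/-- The map `U(R) → U(S)` induced by a homomorphism of algebras `R → S`. -/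
def convMapRange (h : R →ₐ[k] S) : WithConv (A →ₐ[k] R) →* WithConv (A →ₐ[k] S) where
  toFun x := toConv (h.comp x.ofConv)
  map_one' := by
    apply ofConv_injective
    ext a
    simp [AlgHom.convOne_def]
  map_mul' x y := ofConv_injective (AlgHom.comp_convMul_distrib h x y)

lemma convMapRange_ofConv (h : R →ₐ[k] S) (x : WithConv (A →ₐ[k] R)) (a : A) :
    (convMapRange h x).ofConv a = h (x.ofConv a) := rfl

/-- The map on `R`-points induced by a homomorphism of groups. -/
def convPullback (R : Type*) [CommRing R] [Algebra k R] (f : B →ₐc[k] A) :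
    WithConv (A →ₐ[k] R) →* WithConv (B →ₐ[k] R) where
  toFun x := toConv (x.ofConv.comp (f : B →ₐ[k] A))
  map_one' := by
    apply ofConv_injective
    ext a
    simp [AlgHom.convOne_def]
  map_mul' x y := ofConv_injective (AlgHom.convMul_comp_bialgHom_distrib x y f)

lemma convPullback_ofConv (f : B →ₐc[k] A) (x : WithConv (A →ₐ[k] R)) (b : B) :
    (convPullback R f x).ofConv b = x.ofConv (f b) := rfl

end Functoriality

/-! ### One-parameter subgroups in characteristic zero -/

section OneParameter

open WithConv RightCoaction Polynomial

variable {k A : Type*} [Field k] [CommRing A] [Bialgebra k A]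

lemma convMul_ofConv_apply_eq_act (y x : WithConv (A →ₐ[k] k)) (a : A) :
    (y * x).ofConv a = y.ofConv ((regular k A).act x.ofConv.toLinearMap a) := by
  rw [act_apply]
  change LinearMap.mul' k k (TensorProduct.map y.ofConv.toLinearMap x.ofConv.toLinearMap
    (Coalgebra.comul a)) = y.ofConv.toLinearMap (tensorSlice A x.ofConv.toLinearMap
      (Coalgebra.comul a))
  generalize Coalgebra.comul (R := k) a = t
  induction t with
  | zero => simp
  | add x y hx hy => simp only [map_add, hx, hy]
  | tmul x y => simp [mul_comm]

/-- The binomial expansion of `x ^ t = (1 + (x - 1)) ^ t` in the dual algebra. -/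
lemma pow_ofConv_eq_sum_choose (x : WithConv (A →ₐ[k] k)) (t : ℕ) {n : ℕ} {a : A}
    (ha : a ∈ (regular k A).filt n) :
    (x ^ t).ofConv a = ∑ j ∈ Finset.range n, (t.choose j : k) *
      Coalgebra.counit (R := k)
        ((((regular k A).act (x.ofConv.toLinearMap - Coalgebra.counit)) ^ j) a) := by
  set N := (regular k A).act (x.ofConv.toLinearMap - Coalgebra.counit) with hN
  induction t generalizing n a with
  | zero =>
    cases n with
    | zero => simp [(mem_filt_zero _).1 ha]
    | succ n =>
      rw [Finset.sum_range_succ']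
      simp [AlgHom.convOne_def]
  | succ t ih =>
    cases n with
    | zero => simp [(mem_filt_zero _).1 ha]
    | succ n =>
      have hNa : N a ∈ (regular k A).filt n := (mem_filt_succ _).1 ha _ (by simp)
      have hact : (regular k A).act x.ofConv.toLinearMap a = N a + a := by
        conv_lhs => rw [act_eq_sub_add]
        simp [hN]
      rw [pow_succ, convMul_ofConv_apply_eq_act, hact, map_add, ih hNa, ih ha,
        Finset.sum_range_succ', Finset.sum_range_succ', ← add_assoc, ← Finset.sum_add_distrib]
      congr 1
      · refine Finset.sum_congr rfl fun j _ => ?_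
        rw [Nat.choose_succ_succ, pow_succ N j, Module.End.mul_apply]
        push_cast
        ring
      · simp

lemma Polynomial.eq_of_eval_natCast_eq [CharZero k] {P P' : k[X]}
    (h : ∀ n : ℕ, P.eval (n : k) = P'.eval (n : k)) : P = P' :=
  Polynomial.eq_of_infinite_eval_eq P P' ((Set.infinite_range_of_injective
    (Nat.cast_injective (R := k))).mono (by rintro _ ⟨n, rfl⟩; exact h n))

/-- In characteristic zero, the powers of a point `x` of a pro-unipotent group interpolate to a
one-parameter subgroup `t ↦ x ^ t`. -/
lemma exists_algHom_polynomial_eval_eq_pow [CharZero k] (hA : IsConilpotent k A)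
    (x : WithConv (A →ₐ[k] k)) :
    ∃ Φ : A →ₐ[k] k[X], ∀ a (n : ℕ), (Φ a).eval (n : k) = (x ^ n).ofConv a := by
  have h : ∀ a, ∃ P : k[X], ∀ n : ℕ, P.eval (n : k) = (x ^ n).ofConv a := by
    intro a
    obtain ⟨r, hr⟩ := hA a
    refine ⟨∑ j ∈ Finset.range r, C (Coalgebra.counit (R := k)
        ((((regular k A).act (x.ofConv.toLinearMap - Coalgebra.counit)) ^ j) a) /
          (j.factorial : k)) * descPochhammer k j, fun n => ?_⟩
    rw [pow_ofConv_eq_sum_choose x n hr, eval_finsetSum]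
    refine Finset.sum_congr rfl fun j _ => ?_
    rw [eval_mul, eval_C, descPochhammer_eval_eq_descFactorial,
      Nat.descFactorial_eq_factorial_mul_choose]
    have : (j.factorial : k) ≠ 0 := Nat.cast_ne_zero.2 j.factorial_ne_zero
    push_cast
    field_simp
  choose P hP using h
  refine ⟨{ toFun := P, map_one' := ?_, map_mul' := ?_, map_zero' := ?_, map_add' := ?_,
            commutes' := ?_ }, hP⟩
  all_goals intros; apply Polynomial.eq_of_eval_natCast_eq; intro n; simp [hP]

/-- In characteristic zero, every point of a pro-unipotent group has `m`-th roots, and these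
lie in every closed subgroup that contains the point. -/
lemma exists_pow_eq_of_isConilpotent [CharZero k] (hA : IsConilpotent k A)
    (x : WithConv (A →ₐ[k] k)) {m : ℕ} (hm : m ≠ 0) :
    ∃ y : WithConv (A →ₐ[k] k), y ^ m = x ∧
      ∀ a, (∀ n : ℕ, (x ^ n).ofConv a = 0) → y.ofConv a = 0 := by
  obtain ⟨Φ, hΦ⟩ := exists_algHom_polynomial_eval_eq_pow hA x
  have hm' : (m : k) ≠ 0 := Nat.cast_ne_zero.2 hm
  have hev : ∀ n : ℕ, convMapRange (aeval (n : k)) (toConv Φ) = x ^ n := by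
    intro n
    apply ofConv_injective
    ext a
    rw [convMapRange_ofConv, ← hΦ, coe_aeval_eq_eval]
  -- `(x ^ t) ^ m = x ^ (m t)` for all natural `t`, hence identically in `t`.
  have hpow : (toConv Φ) ^ m = convMapRange (aeval (C (m : k) * X)) (toConv Φ) := by
    apply ofConv_injective
    ext1 a
    apply Polynomial.eq_of_eval_natCast_eq
    intro n
    have h1 := congrArg (fun z => z.ofConv a)
      (map_pow (convMapRange (A := A) (aeval (n : k))) (toConv Φ) m)
    simp only [hev] at h1
    rw [convMapRange_ofConv, coe_aeval_eq_eval] at h1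
    rw [h1, convMapRange_ofConv, ← pow_mul, ← hΦ]
    change _ = eval _ (aeval _ (Φ a))
    rw [← coe_aeval_eq_eval (n : k), ← aeval_algHom_apply]
    simp [coe_aeval_eq_eval, mul_comm]
  refine ⟨convMapRange (aeval (m : k)⁻¹) (toConv Φ), ?_, ?_⟩
  · rw [← map_pow, hpow]
    apply ofConv_injective
    ext a
    rw [convMapRange_ofConv, convMapRange_ofConv]
    have h1 := hΦ a 1
    rw [pow_one] at h1
    rw [← h1, ← aeval_algHom_apply]
    simp [coe_aeval_eq_eval, hm']
  · intro a ha
    have h0 : Φ a = 0 := Polynomial.eq_of_eval_natCast_eq fun n => by rw [hΦ, ha, eval_zero]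
    rw [convMapRange_ofConv]
    simp [h0]

end OneParameter

/-! ### The filtration of the group of rational points -/

namespace AffineGroup

open WithConv

section ClosedSubgroup

variable {k A : Type u} [Field k] [CommRing A] [HopfAlgebra k A]

/-- The subgroup `N(k)` of `U(k)`, for a closed subgroup `N = V(I)`. -/
noncomputable def pointsSubgroup (k : Type u) {A : Type u} [Field k] [CommRing A]
    [HopfAlgebra k A] (I : Ideal A) [I.IsHopfIdeal k] : Subgroup (Points k A k) :=
  (convPullback k (Bialgebra.Quotient.mkBialgHom (R := k) I)).range

variable (I : Ideal A) [I.IsHopfIdeal k]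

lemma mem_pointsSubgroup {x : Points k A k} :
    x ∈ pointsSubgroup k I ↔ ∀ a ∈ I, x.ofConv a = 0 := by
  constructor
  · rintro ⟨y, rfl⟩ a ha
    rw [convPullback_ofConv]
    have : Bialgebra.Quotient.mkBialgHom (R := k) I a = 0 := Ideal.Quotient.eq_zero_iff_mem.2 ha
    rw [this, map_zero]
  · intro h
    refine ⟨toConv (Ideal.Quotient.liftₐ I x.ofConv h), ?_⟩
    apply ofConv_injective
    ext a
    rfl

lemma convPullback_mk_injective :
    Function.Injective (convPullback k (Bialgebra.Quotient.mkBialgHom (R := k) I)) := by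
  intro x y hxy
  apply ofConv_injective
  ext a
  obtain ⟨a, rfl⟩ := Ideal.Quotient.mk_surjective a
  exact congrArg (fun z => z.ofConv a) hxy

/-- Points of `V(I)`, as points of its coordinate ring. -/
noncomputable def pointsSubgroupEquiv : Points k (A ⧸ I) k ≃* pointsSubgroup k I :=
  MonoidHom.ofInjective (convPullback_mk_injective I)

/-- Points of `U` which agree modulo `V(I)` take the same values at the functions
on `U / V(I)`. -/
lemma ofConv_eq_of_mem_invariants {x y : Points k A k} (h : x⁻¹ * y ∈ pointsSubgroup k I) {a : A}
    (ha : a ∈ invariants k I) : y.ofConv a = x.ofConv a := by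
  obtain ⟨n, hn⟩ := h
  have hy : y = x * convPullback k (Bialgebra.Quotient.mkBialgHom (R := k) I) n := by
    rw [hn, mul_inv_cancel_left]
  have ha' : (Algebra.TensorProduct.map (AlgHom.id k A) (Ideal.Quotient.mkₐ k I))
      (Coalgebra.comul (R := k) a) = a ⊗ₜ 1 := ha
  have h1 := congrArg (Algebra.TensorProduct.lift x.ofConv n.ofConv (fun _ _ => .all ..)) ha'
  rw [Algebra.TensorProduct.lift_tmul, map_one, mul_one] at h1
  rw [hy, ← h1]
  refine (AlgHom.convMul_apply _ _ _).trans ?_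
  rw [← AlgHom.comp_apply]
  congr 1
  ext b
  · simp
  · simp only [AlgHom.comp_apply, Algebra.TensorProduct.includeRight_apply,
      AlgHom.coe_restrictScalars', Algebra.TensorProduct.lift_tmul, Algebra.TensorProduct.map_tmul,
      map_one, one_mul]
    rfl

end ClosedSubgroup

section Limit

variable {k A : Type u} [Field k] [CommRing A] [HopfAlgebra k A] (I : ℕ → Ideal A)
  [∀ i, (I i).IsHopfIdeal k]

lemma pointsSubgroup_antitone (hI_mono : Monotone I) :
    Antitone fun i => pointsSubgroup k (I i) := by
  intro i j hij x hx
  rw [mem_pointsSubgroup] at hx ⊢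
  exact fun a ha => hx a (hI_mono hij ha)

lemma eq_one_of_forall_mem_pointsSubgroup (hI_lim : IsLimitOfQuotients k I)
    {x : Points k A k} (hx : ∀ i, x ∈ pointsSubgroup k (I i)) : x = 1 := by
  apply ofConv_injective
  ext a
  obtain ⟨i, hi⟩ := hI_lim a
  exact ofConv_eq_of_mem_invariants (I i) (x := 1) (y := x) (by simpa using hx i) hi

/-- `U(k)` is complete for the filtration by the subgroups `U i (k)`. -/
lemma exists_limit_of_points (hI_mono : Monotone I) (hI_lim : IsLimitOfQuotients k I)
    (x : ℕ → Points k A k) (hx : ∀ i, (x i)⁻¹ * x (i + 1) ∈ pointsSubgroup k (I i)) :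
    ∃ y, ∀ i, (x i)⁻¹ * y ∈ pointsSubgroup k (I i) := by
  classical
  have hle : ∀ i j, i ≤ j → (x i)⁻¹ * x j ∈ pointsSubgroup k (I i) := by
    intro i j hij
    induction j, hij using Nat.le_induction with
    | base => simp
    | succ j hij ih =>
      have : (x i)⁻¹ * x (j + 1) = ((x i)⁻¹ * x j) * ((x j)⁻¹ * x (j + 1)) := by group
      rw [this]
      exact mul_mem ih (pointsSubgroup_antitone I hI_mono hij (hx j))
  choose d hd using hI_lim
  have hstab : ∀ a j, d a ≤ j → (x j).ofConv a = (x (d a)).ofConv a := fun a j hj =>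
    ofConv_eq_of_mem_invariants _ (hle _ _ hj) (hd a)
  let y : A →ₐ[k] k :=
    { toFun := fun a => (x (d a)).ofConv a
      map_one' := map_one _
      map_zero' := map_zero _
      map_mul' := fun a b => by
        let j := max (d (a * b)) (max (d a) (d b))
        rw [← hstab a j (by simp [j]), ← hstab b j (by simp [j]),
          ← hstab (a * b) j (by simp [j]), map_mul]
      map_add' := fun a b => by
        let j := max (d (a + b)) (max (d a) (d b))
        rw [← hstab a j (by simp [j]), ← hstab b j (by simp [j]),
          ← hstab (a + b) j (by simp [j]), map_add]
      commutes' := fun c => AlgHom.commutes _ _ }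
  refine ⟨toConv y, fun i => (mem_pointsSubgroup _).2 fun a ha => ?_⟩
  -- Only finitely many values of `y` matter, so `y` may be replaced by `x j` for `j` large.
  obtain ⟨S, hS⟩ := TensorProduct.exists_finset (Coalgebra.comul (R := k) a)
  let j := max i (S.sup fun p => d p.2)
  have h1 : ((x i)⁻¹ * toConv y).ofConv a = ((x i)⁻¹ * x j).ofConv a := by
    refine (AlgHom.convMul_apply _ _ _).trans ((AlgHom.convMul_apply _ _ _).trans ?_).symm
    rw [hS, map_sum, map_sum]
    refine Finset.sum_congr rfl fun p hp => ?_
    rw [Algebra.TensorProduct.lift_tmul, Algebra.TensorProduct.lift_tmul,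
      hstab p.2 j ((Finset.le_sup (f := fun p : A × A => d p.2) hp).trans (le_max_right _ _))]
    rfl
  rw [h1]
  exact (mem_pointsSubgroup _).1 (hle i j (le_max_left _ _)) a ha

end Limit

section Graded

variable {k A Q : Type u} [Field k] [CommRing A] [HopfAlgebra k A] [CommRing Q] [HopfAlgebra k Q]

/-- If `V(I) / V(I')` is unipotent, then `V(I)(k) / V(I')(k)` embeds in a group of unitriangular
matrices over `k`. -/
lemma IsUnipotent.exists_monoidHom (hQ : IsUnipotent k Q) {I I' : Ideal A} [I.IsHopfIdeal k]
    [I'.IsHopfIdeal k]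
    {π : Q →ₐc[k] A ⧸ I} (hπ : IsQuotient (I'.map (Ideal.Quotient.mk I)) π) :
    ∃ (n : ℕ) (ψ : pointsSubgroup k I →* Matrix (Fin n) (Fin n) k),
      (∀ x, ψ x - 1 ∈ superdiagonal n k 1) ∧
        ψ.ker = (pointsSubgroup k I').subgroupOf (pointsSubgroup k I) := by
  obtain ⟨n, m, h1, h0, hΔ, hε, hgen⟩ := hQ
  let ψQ : Points k Q k →* Matrix (Fin n) (Fin n) k :=
    { toFun := fun x => m.map x.ofConv
      map_one' := by
        ext i j
        rw [Matrix.map_apply, Matrix.one_apply]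
        simp [AlgHom.convOne_def, hε]
      map_mul' := fun x y => by
        ext i j
        rw [Matrix.mul_apply, Matrix.map_apply]
        refine (AlgHom.convMul_apply x y (m i j)).trans ?_
        simp [hΔ] }
  refine ⟨n, (ψQ.comp (convPullback k π)).comp (pointsSubgroupEquiv I).symm.toMonoidHom, ?_, ?_⟩
  · intro x i j hij
    rw [Matrix.sub_apply]
    change ((pointsSubgroupEquiv I).symm x).ofConv (π (m i j)) - _ = 0
    rcases eq_or_ne i j with rfl | hne
    · simp [h1]
    · have : (i : ℕ) ≠ j := fun h => hne (Fin.ext h)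
      rw [h0 i j (by rw [Fin.lt_def]; omega), Matrix.one_apply_ne hne]
      simp
  · ext x
    rw [MonoidHom.mem_ker, Subgroup.mem_subgroupOf]
    obtain ⟨y, rfl⟩ := (pointsSubgroupEquiv I).surjective x
    have hy : ((ψQ.comp (convPullback k π)).comp (pointsSubgroupEquiv I).symm.toMonoidHom)
        (pointsSubgroupEquiv I y) = ψQ (convPullback k π y) := by simp
    have hmem : (pointsSubgroupEquiv I y : Points k A k) ∈ pointsSubgroup k I' ↔
        ∀ b ∈ I'.map (Ideal.Quotient.mk I), y.ofConv b = 0 := by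
      rw [mem_pointsSubgroup]
      constructor
      · intro h
        have hle' : I'.map (Ideal.Quotient.mk I) ≤ RingHom.ker y.ofConv :=
          Ideal.map_le_iff_le_comap.2 fun a ha => h a ha
        exact fun b hb => hle' hb
      · exact fun h a ha => h _ (Ideal.mem_map_of_mem _ ha)
    rw [hy, hmem, ← hπ.kernel_eq]
    constructor
    · intro h
      have heq : y.ofConv.comp (π : Q →ₐ[k] A ⧸ I) =
          (Algebra.ofId k k).comp (Bialgebra.counitAlgHom k Q) := by
        refine AlgHom.ext_of_adjoin_eq_top hgen ?_
        rintro _ ⟨i, j, rfl⟩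
        have hij := congrFun (congrFun h i) j
        rw [Matrix.one_apply, ← hε i j] at hij
        exact hij
      have hle' : (RingHom.ker (Bialgebra.counitAlgHom k Q)).map (π : Q →ₐ[k] A ⧸ I) ≤
          RingHom.ker y.ofConv := by
        refine Ideal.map_le_iff_le_comap.2 fun q hq => ?_
        have := DFunLike.congr_fun heq q
        rw [RingHom.mem_ker] at hq
        simp only [AlgHom.comp_apply, hq, map_zero] at this
        exact this
      exact fun b hb => hle' hb
    · intro h
      ext i j
      have hk : m i j - algebraMap k Q (if i = j then 1 else 0) ∈
          RingHom.ker (Bialgebra.counitAlgHom k Q) := by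
        rw [RingHom.mem_ker, map_sub, AlgHom.commutes]
        simp [hε]
      have h2 := h _ (Ideal.mem_map_of_mem (π : Q →ₐ[k] A ⧸ I) hk)
      rw [map_sub, map_sub, AlgHom.commutes, AlgHom.commutes, sub_eq_zero] at h2
      exact h2

/-- The step from `U i` to `U (i + 1)`: a cocycle in `V(I)(k)` is cohomologous to one
in `V(I')(k)`. -/
lemma exists_twist_mem_pointsSubgroup {Γ : Type*} [Group Γ] [Finite Γ]
    (hΓ : (Nat.card Γ : k) ≠ 0) (φ : Γ →* MulAut (Points k A k)) (hA : IsConilpotent k A)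
    (hQ : IsUnipotent k Q) {I I' : Ideal A} [I.IsHopfIdeal k] [I'.IsHopfIdeal k]
    (hI : ∀ s, ∀ x ∈ pointsSubgroup k I, φ s x ∈ pointsSubgroup k I)
    (hI' : ∀ s, ∀ x ∈ pointsSubgroup k I', φ s x ∈ pointsSubgroup k I')
    {π : Q →ₐc[k] A ⧸ I} (hπ : IsQuotient (I'.map (Ideal.Quotient.mk I)) π)
    (c : OneCocycle φ) (hc : ∀ s, c.toFun s ∈ pointsSubgroup k I) :
    ∃ g ∈ pointsSubgroup k I, ∀ s, (c.twist g).toFun s ∈ pointsSubgroup k I' := by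
  obtain ⟨n, ψ, hψ, hker⟩ := hQ.exists_monoidHom hπ
  refine c.exists_twist_mem_of_unitriangular _ _ hI hI' ψ hψ hker hΓ (fun _ x hx => ?_) hc
  obtain ⟨y, hy, hy'⟩ := exists_pow_eq_of_isConilpotent hA x (m := Nat.card Γ) Nat.card_pos.ne'
  exact ⟨y, (mem_pointsSubgroup I).2 fun a ha =>
    hy' a fun r => (mem_pointsSubgroup I).1 (pow_mem hx r) a ha, hy⟩

end Graded

end AffineGroup

theorem lemma4p1 {k : Type u} [Field k] [IsSepClosed k]
    {Γ : Type*} [Group Γ] [Finite Γ] (hΓ : (Nat.card Γ : k) ≠ 0)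
    {A : Type u} [CommRing A] [HopfAlgebra k A] (ρ : AffineGroup.Action k A Γ)
    (I : ℕ → Ideal A) [∀ i, (I i).IsHopfIdeal k]
    (hI_zero : I 0 = ⊥) (hI_mono : Monotone I)
    (hI_normal : ∀ i, AffineGroup.IsNormal k (I i))
    (hI_stable : ∀ i, ρ.Stabilizes (I i))
    (hI_lim : AffineGroup.IsLimitOfQuotients k I)
    (Q : ℕ → Type u) [∀ i, CommRing (Q i)] [∀ i, HopfAlgebra k (Q i)]
    (π : ∀ i, Q i →ₐc[k] A ⧸ I i)
    (hπ : ∀ i, AffineGroup.IsQuotient ((I (i + 1)).map (Ideal.Quotient.mk (I i))) (π i))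
    (hQ_unipotent : ∀ i, AffineGroup.IsUnipotent k (Q i))
    (hQ_smooth : ∀ i, Algebra.Smooth k (Q i))
    (hQ_connected : ∀ i, ConnectedSpace (PrimeSpectrum (Q i))) :
    ∀ x : NonabelianH1 (ρ.onPoints k), x = 1 := by
  have hA : IsConilpotent k A := isConilpotent_of_tower I hI_zero hI_lim Q π hπ
    fun i => (hQ_unipotent i).isConilpotent
  have hstable : ∀ i s, ∀ x ∈ AffineGroup.pointsSubgroup k (I i),
      ρ.onPoints k s x ∈ AffineGroup.pointsSubgroup k (I i) := by
    intro i s x hx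
    rw [AffineGroup.mem_pointsSubgroup] at hx ⊢
    exact fun a ha => hx _ (hI_stable i s a ha)
  intro x
  induction x using Quotient.inductionOn with
  | _ c =>
    obtain ⟨g, hg⟩ := OneCocycle.exists_twist_eq_one_of_filtration
      (fun i => AffineGroup.pointsSubgroup k (I i))
      (by
        rw [eq_top_iff]
        intro x _
        rw [AffineGroup.mem_pointsSubgroup, hI_zero]
        intro a ha
        rw [(Submodule.mem_bot A).1 ha, map_zero])
      hstable (fun x hx => AffineGroup.eq_one_of_forall_mem_pointsSubgroup I hI_lim hx)
      (AffineGroup.exists_limit_of_points I hI_mono hI_lim)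
      (fun i c hc => AffineGroup.exists_twist_mem_pointsSubgroup hΓ _ hA (hQ_unipotent i)
        (hstable i) (hstable (i + 1)) (hπ i) c hc) c
    exact Quotient.sound ⟨g, fun s => (hg s).symm⟩
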